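/- **Setting.** For $i=1,2,\dots$ let $p,n,k\in\mathbb N$, $r\ge 0$, $\sigma>0$, $\phi\in[0,1]$ and a prior $\mathcal P$ on $\mathbb R^p$ be given (all depend on $i$, which is suppressed), with $p\to\infty$. The prior $\mathcal P$ is the law of a signal $\beta$ that almost surely has Euclidean norm $\|\beta\|_2=r$ and has its non-zero entries in a set $\mathcal D\subset\mathbb R$ with $\inf_{x\in\mathcal D}|x|>0$, and whose support is uniformly distributed over the $k$-element subsets of $\{1,\dots,p\}$ (for instance the uniform law on all vectors with exactly $k$ non-zero entries, all in $\mathcal D$, and norm $r$, if $\mathcal D$ is finite and there are such vectors). Let $\|\beta\|_\infty$ denote the essential supremum of $\max_j|\beta_j|$ under $\mathcal P$, and let $\mathrm{SNR}=r^2/\sigma^2$. Sparse linear regression detection is the problem of distinguishing two laws of the data $(X,y)\in\mathbb R^{n\times p}\times\mathbb R^n$, of dimension $N=np+n$. Under both, $X_{ij}$ and $w_i$ are i.i.d. $\mathcal N(0,1)$. Under the null law $Q$, $y=\sqrt{r^2/\sigma^2+1}\;w$. Under the planted law $P$, $y=\frac1\sigma (X\beta_1)\odot z+\frac1\sigma (X\beta_2)\odot(1-z)+w$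 with $\beta_1=\beta_2=\beta\sim\mathcal P$ and $z_i$ i.i.d. Bernoulli$(\phi)$, with $\beta,X,z,w$ independent (so $y=\frac1\sigma X\beta+w$). For $D\in\mathbb N$ let $\chi^2_{\le D}(P\|Q)=\mathbb E_Q[(L^{\le D})^2]-1$, where $L^{\le D}$ is the orthogonal projection in $L^2(Q)$ of the likelihood ratio $L=dP/dQ$ onto the polynomials in $(X,y)$ of total degree at most $D$. **Theorem.** Let $\theta\in(0,1/2]$ and $\varepsilon\in(0,1)$. Suppose that $k=O(p^\theta)$, $k\le\sqrt p$ and $$n\le(1-\varepsilon)(1-2\theta)\,\frac{\|\beta\|_2^2}{\|\beta\|_\infty^2}\,\frac{\mathrm{SNR}+1}{\mathrm{SNR}}\,\log p .$$ 1. There is a constant $C$ such that for all sufficiently large $i$ and all $D\le\frac{2\varepsilon}{1-\varepsilon}n$ we have $P\ll Q$, $L\in L^2(Q)$ and $\chi^2_{\le D}(P\|Q)\le C$. 2. Suppose moreover that $n=\omega(\log p)$, and that the low-degree conjecture holds for this sequence of testing problems, that is: whenever $D=\omega(\log N)$ and $\chi^2_{\le D}(P\|Q)=O(1)$, no randomized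 algorithm solves strong detection in time polynomial in $N$, and furthermore every randomized algorithm that solves strong detection requires running time $e^{\tilde\Omega(D)}$. Then no randomized algorithm solves strong detection in time polynomial in $N$, and every randomized algorithm that solves strong detection requires running time $e^{\tilde\Omega(n)}$. Here a randomized algorithm is a program of a random-access machine over the reals (arithmetic operations and comparisons of reals, natural-number index registers for addressing, and fair coin tosses, each at unit cost) that is given $n,p,k,\sigma,r,\|\beta\|_\infty,\phi$ and the data $(X,y)$. It solves strong detection in time $T$ if under each of $P$ and $Q$ it halts within $T$ steps with the correct answer with probability $1-o(1)$. Running time $e^{\tilde\Omega(f)}$ is required if for every algorithm that solves strong detection in time $T$ there are $c>0$ and $a\in\mathbb N$ with $T\ge\exp(c f/(\log N)^a)$ for all sufficiently large $i$. -/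

import Mathlib

open MeasureTheory ProbabilityTheory Filter Asymptotics

/-! ## The low-degree chi-square divergence -/

section LowDegree

variable {ι : Type} [Fintype ι]

/-- The functions in `L²(Q)` that are represented by a polynomial of total degree at most `D` in
the coordinates of `x ∈ ℝ^ι`. -/
def lowDegSubspace (Q : Measure (ι → ℝ)) (D : ℕ) : Submodule ℝ (Lp ℝ 2 Q) where
  carrier := {g | ∃ f : MvPolynomial ι ℝ, f.totalDegree ≤ D ∧ g =ᵐ[Q] fun x => MvPolynomial.eval x f}
  zero_mem' := ⟨0, by simp, (Lp.coeFn_zero ℝ 2 Q).trans (Eventually.of_forall fun x => by simp)⟩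
  add_mem' := by
    rintro g₁ g₂ ⟨f₁, hd₁, h₁⟩ ⟨f₂, hd₂, h₂⟩
    refine ⟨f₁ + f₂, (MvPolynomial.totalDegree_add _ _).trans (max_le hd₁ hd₂), ?_⟩
    filter_upwards [Lp.coeFn_add g₁ g₂, h₁, h₂] with x hx hx₁ hx₂
    rw [hx, Pi.add_apply, hx₁, hx₂, map_add]
  smul_mem' := by
    rintro c g ⟨f, hd, h⟩
    refine ⟨c • f, (MvPolynomial.totalDegree_smul_le _ _).trans hd, ?_⟩
    filter_upwards [Lp.coeFn_smul c g, h] with x hx hx₁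
    rw [hx, Pi.smul_apply, hx₁, MvPolynomial.smul_eval, smul_eq_mul]

instance lowDegSubspace_finiteDimensional (Q : Measure (ι → ℝ)) (D : ℕ) :
    FiniteDimensional ℝ (lowDegSubspace Q D) := by
  let W : Submodule ℝ (MvPolynomial ι ℝ) :=
    { carrier := {f | f.totalDegree ≤ D ∧ MemLp (fun x => MvPolynomial.eval x f) 2 Q}
      zero_mem' := ⟨by simp, by simp⟩
      add_mem' := fun {f₁ f₂} h₁ h₂ =>
        ⟨(MvPolynomial.totalDegree_add _ _).trans (max_le h₁.1 h₂.1), by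
          refine (h₁.2.add h₂.2).ae_eq ?_
          exact Eventually.of_forall fun x => by simp⟩
      smul_mem' := fun c f h =>
        ⟨(MvPolynomial.totalDegree_smul_le _ _).trans h.1, by
          refine (h.2.const_smul c).ae_eq ?_
          exact Eventually.of_forall fun x => by simp⟩ }
  have hW : W ≤ MvPolynomial.restrictTotalDegree ι ℝ D := fun f hf =>
    (MvPolynomial.mem_restrictTotalDegree _ _ _).2 hf.1
  have : FiniteDimensional ℝ W := Submodule.finiteDimensional_of_le hW
  let T : W →ₗ[ℝ] Lp ℝ 2 Q :=
    { toFun := fun f => f.2.2.toLp _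
      map_add' := fun f₁ f₂ => by
        rw [← MemLp.toLp_add]
        exact MemLp.toLp_congr _ _ (Eventually.of_forall fun x => by simp)
      map_smul' := fun c f => by
        simp only [RingHom.id_apply]
        rw [← MemLp.toLp_const_smul]
        exact MemLp.toLp_congr _ _ (Eventually.of_forall fun x => by simp) }
  have hT : lowDegSubspace Q D ≤ LinearMap.range T := by
    rintro g ⟨f, hd, h⟩
    have hf : MemLp (fun x => MvPolynomial.eval x f) 2 Q := (Lp.memLp g).ae_eq h
    exact ⟨⟨f, hd, hf⟩, Lp.ext ((MemLp.coeFn_toLp hf).trans h.symm)⟩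
  exact Submodule.finiteDimensional_of_le hT

/-- The likelihood ratio `L = dP/dQ`. -/
noncomputable def likelihoodRatio (P Q : Measure (ι → ℝ)) (x : ι → ℝ) : ℝ :=
  (P.rnDeriv Q x).toReal

open Classical in
/-- The degree-`D` chi-square divergence `χ²_{≤D}(P ‖ Q) = E_Q[(L^{≤D})²] - 1`, where `L^{≤D}` is the
orthogonal projection in `L²(Q)` of the likelihood ratio `L = dP/dQ` onto the polynomials of degree
at most `D`. It is `+∞` by convention unless `P ≪ Q` and `L ∈ L²(Q)`, so an upper bound by a real
number includes these two facts. -/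
noncomputable def lowDegChiSq (P Q : Measure (ι → ℝ)) (D : ℕ) : EReal :=
  if h : P ≪ Q ∧ MemLp (likelihoodRatio P Q) 2 Q then
    (((∫ x, ((lowDegSubspace Q D).starProjection (h.2.toLp _) x) ^ 2 ∂Q) - 1 : ℝ) : EReal)
  else ⊤

end LowDegree

/-! ## Signal priors -/

/-- `P` is the law of a random `k`-sparse signal `β ∈ ℝ^p` of Euclidean norm `r`: the non-zero
entries lie in `𝒟`, a set of reals bounded away from `0`, and the support is uniform among the
`k`-element subsets of the `p` coordinates. The uniform law on the set of all such vectors is the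
basic instance, see `isSparsePrior_uniformOn`. -/
structure IsSparsePrior {p : ℕ} (k : ℕ) (r : ℝ) (𝒟 : Set ℝ) (P : Measure (Fin p → ℝ)) : Prop where
  isProbabilityMeasure : IsProbabilityMeasure P
  amplitude_pos : ∃ b : ℝ, 0 < b ∧ ∀ x ∈ 𝒟, b ≤ |x|
  entries_mem : ∀ᵐ β ∂P, ∀ j, β j ≠ 0 → β j ∈ 𝒟
  norm_eq : ∀ᵐ β ∂P, ‖WithLp.toLp 2 β‖ = r
  support_uniform : ∀ S : Finset (Fin p), S.card = k →
    P {β | Function.support β = (S : Set (Fin p))} = ((p.choose k : ℕ) : ENNReal)⁻¹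

/-- The set of all vectors with exactly `k` non-zero entries, all in `𝒟`, and Euclidean norm `r`. -/
def sparseVectors (p k : ℕ) (r : ℝ) (𝒟 : Set ℝ) : Set (Fin p → ℝ) :=
  {β | (Function.support β).ncard = k ∧ (∀ j, β j ≠ 0 → β j ∈ 𝒟) ∧ ‖WithLp.toLp 2 β‖ = r}

/-- The uniform law on the `k`-sparse vectors of norm `r` with non-zero entries in a finite set of
amplitudes satisfies `IsSparsePrior`. -/
theorem isSparsePrior_uniformOn {p k : ℕ} {r : ℝ} {𝒟 : Set ℝ} (h𝒟 : 𝒟.Finite) (h0 : (0 : ℝ) ∉ 𝒟)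
    (hne : (sparseVectors p k r 𝒟).Nonempty) :
    IsSparsePrior k r 𝒟 (uniformOn (sparseVectors p k r 𝒟)) := by
  classical
  set A := sparseVectors p k r 𝒟 with hA
  have hfin : A.Finite := by
    refine (Set.Finite.pi' (t := fun _ : Fin p => insert (0 : ℝ) 𝒟)
      fun _ => h𝒟.insert 0).subset ?_
    intro β hβ j
    by_cases h : β j = 0
    · exact Or.inl h
    · exact Or.inr (hβ.2.1 j h)
  have hprob : IsProbabilityMeasure (uniformOn A) := isProbabilityMeasure_uniformOn hfin hne
  have hae : ∀ᵐ β ∂(uniformOn A), β ∈ A := by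
    rw [ae_iff, uniformOn_eq_zero_iff hfin]
    ext β
    simp
  let B : Finset (Fin p) → Set (Fin p → ℝ) :=
    fun S => A ∩ {β | Function.support β = (S : Set (Fin p))}
  have hBfin : ∀ S, (B S).Finite := fun S => hfin.subset Set.inter_subset_left
  -- permuting the coordinates carries one support to the other
  have hle : ∀ S S' : Finset (Fin p), S.card = k → S'.card = k →
      Measure.count (B S) ≤ Measure.count (B S') := by
    intro S S' hS hS'
    obtain ⟨e, he⟩ : ∃ e : Equiv.Perm (Fin p), S'.map e.toEmbedding = S := by
      have hcard : S'.card = S.card := hS'.trans hS.symm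
      let e₀ : {x // x ∈ S'} ≃ {x // x ∈ S} := Finset.equivOfCardEq hcard
      refine ⟨e₀.extendSubtype, ?_⟩
      ext x
      simp only [Finset.mem_map, Equiv.coe_toEmbedding]
      constructor
      · rintro ⟨y, hy, rfl⟩
        exact e₀.extendSubtype_mem y hy
      · intro hx
        refine ⟨e₀.symm ⟨x, hx⟩, (e₀.symm ⟨x, hx⟩).2, ?_⟩
        rw [Equiv.extendSubtype_apply_of_mem _ _ (e₀.symm ⟨x, hx⟩).2]
        simp
    have hinj : Function.Injective fun β : Fin p → ℝ => β ∘ e := fun β γ h =>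
      e.surjective.injective_comp_right h
    rw [← Measure.count_injective_image hinj (B S)]
    refine measure_mono ?_
    rintro _ ⟨β, ⟨⟨h1, h2, h3⟩, h4⟩, rfl⟩
    have hsupp : Function.support (β ∘ e) = (S' : Set (Fin p)) := by
      ext x
      have h5 : e x ∈ Function.support β ↔ e x ∈ S := by
        rw [h4]; simp
      rw [Function.mem_support, Function.comp_apply, ← Function.mem_support, h5, ← he]
      simp
    refine ⟨⟨?_, fun j hj => h2 _ hj, ?_⟩, hsupp⟩
    · rw [hsupp, Set.ncard_coe_finset, hS']
    · rw [← h3, EuclideanSpace.norm_eq, EuclideanSpace.norm_eq]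
      congr 1
      exact Equiv.sum_comp e fun j => ‖β j‖ ^ 2
  have hunion : A = ⋃ S ∈ Finset.powersetCard k (Finset.univ : Finset (Fin p)), B S := by
    ext β
    simp only [Set.mem_iUnion, Finset.mem_powersetCard_univ]
    constructor
    · intro hβ
      refine ⟨(Function.support β).toFinset, ?_, hβ, by simp⟩
      rw [← hβ.1, Set.ncard_eq_toFinset_card']
    · rintro ⟨S, -, hβ⟩
      exact hβ.1
  refine ⟨hprob, ?_, hae.mono fun β hβ => hβ.2.1, hae.mono fun β hβ => hβ.2.2, ?_⟩
  · rcases 𝒟.eq_empty_or_nonempty with rfl | hD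
    · exact ⟨1, one_pos, by simp⟩
    · obtain ⟨x, hx, hmin⟩ := Set.exists_min_image 𝒟 (fun x => |x|) h𝒟 hD
      exact ⟨|x|, abs_pos.2 fun h => h0 (h ▸ hx), hmin⟩
  · intro S hS
    have hcount : Measure.count A = (p.choose k : ENNReal) * Measure.count (B S) := by
      conv_lhs => rw [hunion]
      rw [measure_biUnion_finset]
      · rw [Finset.sum_congr rfl (g := fun _ => Measure.count (B S))]
        · simp
        · intro S' hS'
          rw [Finset.mem_powersetCard_univ] at hS'
          exact le_antisymm (hle _ _ hS' hS) (hle _ _ hS hS')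
      · intro S₁ _ S₂ _ h
        refine Set.disjoint_left.2 fun β h₁ h₂ => h ?_
        exact Finset.coe_injective (h₁.2.symm.trans h₂.2)
      · exact fun S' _ => (hBfin S').measurableSet
    have hA0 : Measure.count A ≠ 0 := Measure.count_ne_zero hne
    have hAtop : Measure.count A ≠ ⊤ := (Measure.count_apply_lt_top.2 hfin).ne
    have hB0 : Measure.count (B S) ≠ 0 := fun h => hA0 (by rw [hcount, h, mul_zero])
    have hBtop : Measure.count (B S) ≠ ⊤ := (Measure.count_apply_lt_top.2 (hBfin S)).ne
    rw [uniformOn, cond_apply hfin.measurableSet, hcount,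
      ENNReal.mul_inv (Or.inr hBtop) (Or.inr hB0), mul_assoc]
    change _ * (_ * Measure.count (B S)) = _
    rw [ENNReal.inv_mul_cancel hB0 hBtop, mul_one]

/-- `‖β‖_∞` for the prior: the (essential) supremum over the signals `β` of `max_j |β_j|`. (The norm
of `Fin p → ℝ` is the sup norm.) -/
noncomputable def signalSupNorm {p : ℕ} (P : Measure (Fin p → ℝ)) : ℝ :=
  essSup (fun β => ‖β‖) P

/-! ## Detection in mixed sparse linear regression -/

/-- The coordinates of the data `(X, y)`, with `X` an `n × p` matrix and `y ∈ ℝ^n`. -/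
abbrev DataIndex (n p : ℕ) : Type := (Fin n × Fin p) ⊕ Fin n

/-- The law of a matrix (or vector) with i.i.d. standard Gaussian entries. -/
noncomputable def gaussianEntries (ι : Type) [Fintype ι] : Measure (ι → ℝ) :=
  Measure.pi fun _ => gaussianReal 0 1

/-- The null hypothesis: `X` has i.i.d. `N(0,1)` entries and, independently of `X`,
`y = √(r²/σ² + 1) · w` with `w` standard Gaussian. -/
noncomputable def mslrdNull (n p : ℕ) (r σ : ℝ) : Measure (DataIndex n p → ℝ) :=
  ((gaussianEntries (Fin n × Fin p)).prod (gaussianEntries (Fin n))).map fun q =>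
    Sum.elim q.1 fun i => √(r ^ 2 / σ ^ 2 + 1) * q.2 i

/-- The planted hypothesis: `(β₁, β₂)` has law `prior`, `X` and `w` have i.i.d. `N(0,1)` entries, the
labels `zᵢ` are i.i.d. Bernoulli(`φ`) with values in `{0, 1}`, these are independent, and
`y = σ⁻¹ (X β₁) ⊙ z + σ⁻¹ (X β₂) ⊙ (1 - z) + w`. -/
noncomputable def mslrdPlanted (n p : ℕ) (σ : ℝ) (φ : unitInterval)
    (prior : Measure ((Fin p → ℝ) × (Fin p → ℝ))) : Measure (DataIndex n p → ℝ) :=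
  ((prior.prod (gaussianEntries (Fin n × Fin p))).prod
      ((Measure.pi fun _ : Fin n => bernoulliMeasure (1 : ℝ) 0 φ).prod
        (gaussianEntries (Fin n)))).map fun q =>
    Sum.elim q.1.2 fun i =>
      σ⁻¹ * (∑ j, q.1.2 (i, j) * q.1.1.1 j) * q.2.1 i
        + σ⁻¹ * (∑ j, q.1.2 (i, j) * q.1.1.2 j) * (1 - q.2.1 i) + q.2.2 i

/-- The planted hypothesis of sparse linear regression: `β₁ = β₂ = β` with `β` of law `P`. -/
noncomputable def slrdPlanted (n p : ℕ) (σ : ℝ) (φ : unitInterval) (P : Measure (Fin p → ℝ)) :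
    Measure (DataIndex n p → ℝ) :=
  mslrdPlanted n p σ φ (P.map fun β => (β, β))

/-! ## Randomized algorithms on real data and their running time

A random-access machine over the reals in the style of Blum, Shub and Smale. It has real registers,
index registers that hold natural numbers and are used as addresses and counters, and fair coins.
Each executed instruction costs one unit of time. -/

/-- The instructions; `a b c` are numbers of real registers, `i j l` are numbers of index registers,
and `t` is the number of the instruction to which a jump leads. -/
inductive Instr where
  /-- `R[a] := q` -/
  | const (a : ℕ) (q : ℚ)
  /-- `R[a] := R[b] + R[c]` -/
  | plus (a b c : ℕ)
  /-- `R[a] := R[b] - R[c]` -/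
  | minus (a b c : ℕ)
  /-- `R[a] := R[b] * R[c]` -/
  | times (a b c : ℕ)
  /-- `R[a] := R[b] / R[c]` -/
  | over (a b c : ℕ)
  /-- `R[a] := R[I[i]]` -/
  | load (a i : ℕ)
  /-- `R[I[i]] := R[a]` -/
  | store (i a : ℕ)
  /-- `I[i] := m` -/
  | idxConst (i m : ℕ)
  /-- `I[i] := I[j] + I[l]` -/
  | idxPlus (i j l : ℕ)
  /-- `I[i] := I[j] - I[l]`, truncated at `0` -/
  | idxMinus (i j l : ℕ)
  /-- `R[a] := I[i]` -/
  | ofIdx (a i : ℕ)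
  /-- `R[a] :=` a fresh fair coin in `{0, 1}` -/
  | flip (a : ℕ)
  /-- jump to instruction `t` if `R[a] < R[b]` -/
  | jump (a b t : ℕ)
  /-- jump to instruction `t` if `I[i] < I[j]` -/
  | idxJump (i j t : ℕ)
  /-- stop and output `v` (`true` stands for the planted, `false` for the null hypothesis) -/
  | halt (v : Bool)

/-- An algorithm: a finite list of instructions. -/
abbrev Program : Type := List Instr

/-- The contents of the real and of the index registers. -/
structure Memory where
  real : ℕ → ℝ
  idx : ℕ → ℕ

/-- A configuration: the memory, the number of the next instruction, the number of coins used so far,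
and the output once the machine has stopped. -/
structure Config where
  mem : Memory
  pc : ℕ
  coins : ℕ
  out : Option Bool

namespace Config

/-- Write `x` into real register `a` and move on to the next instruction. -/
noncomputable def setReal (s : Config) (a : ℕ) (x : ℝ) : Config :=
  { s with mem := { s.mem with real := Function.update s.mem.real a x }, pc := s.pc + 1 }

/-- Write `m` into index register `i` and move on to the next instruction. -/
def setIdx (s : Config) (i m : ℕ) : Config :=
  { s with mem := { s.mem with idx := Function.update s.mem.idx i m }, pc := s.pc + 1 }

open Classical in
/-- Execution of one instruction, with the sequence `ω` of coin tosses. -/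
noncomputable def exec (ω : ℕ → Bool) (s : Config) : Instr → Config
  | .const a q => s.setReal a q
  | .plus a b c => s.setReal a (s.mem.real b + s.mem.real c)
  | .minus a b c => s.setReal a (s.mem.real b - s.mem.real c)
  | .times a b c => s.setReal a (s.mem.real b * s.mem.real c)
  | .over a b c => s.setReal a (s.mem.real b / s.mem.real c)
  | .load a i => s.setReal a (s.mem.real (s.mem.idx i))
  | .store i a => s.setReal (s.mem.idx i) (s.mem.real a)
  | .idxConst i m => s.setIdx i m
  | .idxPlus i j l => s.setIdx i (s.mem.idx j + s.mem.idx l)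
  | .idxMinus i j l => s.setIdx i (s.mem.idx j - s.mem.idx l)
  | .ofIdx a i => s.setReal a (s.mem.idx i)
  | .flip a => { s.setReal a (if ω s.coins then 1 else 0) with coins := s.coins + 1 }
  | .jump a b t => { s with pc := if s.mem.real a < s.mem.real b then t else s.pc + 1 }
  | .idxJump i j t => { s with pc := if s.mem.idx i < s.mem.idx j then t else s.pc + 1 }
  | .halt v => { s with out := some v }

/-- One step of the program `A`; a machine that has stopped, or whose program counter points outside
the program, does not move any more. -/
noncomputable def step (A : Program) (ω : ℕ → Bool) (s : Config) : Config :=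
  match s.out, A[s.pc]? with
  | none, some c => s.exec ω c
  | _, _ => s

end Config

/-- The output of the program `A`, started with memory `m` and with coin tosses `ω`, if there is one
within `T` steps. -/
noncomputable def Program.outputWithin (A : Program) (m : Memory) (ω : ℕ → Bool) (T : ℕ) :
    Option Bool :=
  ((Config.step A ω)^[T] ⟨m, 0, 0, none⟩).out

/-- The law of an infinite sequence of independent fair coins. -/
noncomputable def fairCoins : Measure (ℕ → Bool) :=
  Measure.infinitePi fun _ => (PMF.uniformOfFintype Bool).toMeasure

/-! ## Strong detection and the low-degree conjecture -/

/-- A problem of distinguishing two laws on `ℝ^N`, `N` being the cardinality of `Idx`, together with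
the way in which a sample is written into the memory of a machine. -/
structure TestingProblem where
  Idx : Type
  fintypeIdx : Fintype Idx
  planted : Measure (Idx → ℝ)
  null : Measure (Idx → ℝ)
  input : (Idx → ℝ) → Memory

attribute [instance] TestingProblem.fintypeIdx

/-- The dimension `N` of the data. -/
def TestingProblem.dim (t : TestingProblem) : ℕ := Fintype.card t.Idx

/-- The randomized algorithm `A` solves strong detection for the sequence `F` in time `T`: under each
of the two hypotheses, it gives the right answer within `T i` steps with probability `1 - o(1)`, over
the sample and the coins. -/
def StronglyDetectsInTime (F : ℕ → TestingProblem) (A : Program) (T : ℕ → ℕ) : Prop :=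
  Tendsto (fun i => ((F i).planted.prod fairCoins)
    {q | A.outputWithin ((F i).input q.1) q.2 (T i) = some true}) atTop (nhds 1) ∧
  Tendsto (fun i => ((F i).null.prod fairCoins)
    {q | A.outputWithin ((F i).input q.1) q.2 (T i) = some false}) atTop (nhds 1)

/-- No randomized algorithm solves strong detection in time polynomial in the dimension. -/
def NoPolyTimeDetection (F : ℕ → TestingProblem) : Prop :=
  ∀ (A : Program) (T : ℕ → ℕ), StronglyDetectsInTime F A T →
    ∀ a : ℕ, ¬ (fun i => (T i : ℝ)) =O[atTop] fun i => ((F i).dim : ℝ) ^ a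

/-- Every randomized algorithm for strong detection has running time `exp(Ω̃(f))`, where `Ω̃` hides
constants and powers of the logarithm of the dimension. -/
def DetectionRequiresExpTime (F : ℕ → TestingProblem) (f : ℕ → ℝ) : Prop :=
  ∀ (A : Program) (T : ℕ → ℕ), StronglyDetectsInTime F A T →
    ∃ c : ℝ, 0 < c ∧ ∃ a : ℕ, ∀ᶠ i in atTop,
      Real.exp (c * f i / Real.log (F i).dim ^ a) ≤ T i

/-- The low-degree conjecture for the sequence `F` of testing problems: if `χ²_{≤D} = O(1)` for some
`D = ω(log N)`, then strong detection has no polynomial-time algorithm and furthermore requires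
running time `exp(Ω̃(D))`. -/
def LowDegreeConjectureFor (F : ℕ → TestingProblem) : Prop :=
  ∀ D : ℕ → ℕ,
    (fun i => Real.log (F i).dim) =o[atTop] (fun i => (D i : ℝ)) →
    (∃ C : ℝ, ∀ᶠ i in atTop, lowDegChiSq (F i).planted (F i).null (D i) ≤ C) →
    NoPolyTimeDetection F ∧ DetectionRequiresExpTime F fun i => D i

/-- The data `(X, y)` as an input of a machine: the index registers start with `n`, `p`, `k`, the real
registers with `σ`, `‖β‖₂`, `‖β‖_∞`, `φ`, the rows of `X`, and `y`; all others are `0`. -/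
noncomputable def slrdInput (n p k : ℕ) (σ r b φ : ℝ) (x : DataIndex n p → ℝ) : Memory where
  real := fun a => (([σ, r, b, φ] ++
    (List.ofFn fun i : Fin n => List.ofFn fun j : Fin p => x (Sum.inl (i, j))).flatten ++
    List.ofFn fun i : Fin n => x (Sum.inr i)).getD a 0)
  idx := fun i => [n, p, k].getD i 0

/-- The detection problem of sparse linear regression with `n` samples in dimension `p`. -/
noncomputable def slrd (n p k : ℕ) (r σ : ℝ) (φ : unitInterval) (P : Measure (Fin p → ℝ)) :
    TestingProblem where
  Idx := DataIndex n p
  fintypeIdx := inferInstance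
  planted := slrdPlanted n p σ φ P
  null := mslrdNull n p r σ
  input := slrdInput n p k σ r (signalSupNorm P) φ

/-! Dividing the responses by s = √(r²/σ² + 1) turns the null law into the standard Gaussian law γ.
Given β, the planted law then becomes a centred Gaussian law with unit variances whose only
correlations are a_j between X_ij and y_i, where a = β/(σs). Hence the planted expectation of a
polynomial f is E_γ[exp(Δ_a) f] with Δ_a = Σ_i ∂_{y_i} ∂_{a, row i}. Since Δ_a lowers the degree by
2, for deg f ≤ D the exponential series stops at m = ⌊D/2⌋, and passing to adjoints in L²(γ) writes
the expectation as ⟨K_a, f⟩ with K_a = Σ_{m ≤ D/2} (Δ_a*)^m 1 / m! (`plantedKernel`). The operators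
Δ_a, Δ_b* and a number operator satisfy sl₂-type commutation relations on the powers that occur,
which give ⟨K_a, K_b⟩ = Σ_{m ≤ D/2} n(n+1)⋯(n+m-1)/m! · ⟨a,b⟩^m. This part is pure algebra, valid
for every linear functional that obeys Gaussian integration by parts.

The projection g = L^{≤D} satisfies ‖g‖² = ⟨L, g⟩ = E_P[g], and this is the inner product of the
rescaled g with the mixture E_β[K_a]. By Cauchy-Schwarz, ‖g‖² ≤ E_{β,β'}⟨K_a, K_a'⟩ for two
independent signals (`lowDegChiSq_slrd_le`). That L is square integrable is proved separately, by an
explicit dominating function (`memLp_densityBound`).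

It remains to bound an exponential moment. The rising factorial is at most (n + D/2)^m, so the
kernel product is at most exp((n + D/2)|⟨a,a'⟩|). The degree constraint gives n + D/2 ≤ n/(1-ε);
moreover |⟨β,β'⟩| ≤ ‖β‖_∞² |S ∩ S'| for the supports S, S', and the sample size bound makes the
exponent at most (1-2θ) log p · |S ∩ S'|. For uniform k-sets E x^{|S ∩ S'|} ≤ exp(x k²/p)
(`sum_pow_card_inter_le`), and x = p^{1-2θ} yields exp((k/p^θ)²), which is bounded.

For hardness, the conjecture is applied with D = ⌊2εn/(1-ε)⌋, which is of order n, while log N =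
o(n). -/

/-! ### Gaussian integration by parts on polynomials -/

section Wick

open MvPolynomial

/-- The derivative of polynomials in the direction `a`. -/
noncomputable def dirDeriv {κ : Type} (a : κ → ℝ) :
    Derivation ℝ (MvPolynomial κ ℝ) (MvPolynomial κ ℝ) :=
  mkDerivation ℝ fun k => C (a k)

theorem dirDeriv_X {κ : Type} (a : κ → ℝ) (k : κ) : dirDeriv a (X k) = C (a k) :=
  mkDerivation_X _ _ _

theorem dirDeriv_comm {κ : Type} (a b : κ → ℝ) (f : MvPolynomial κ ℝ) :
    dirDeriv a (dirDeriv b f) = dirDeriv b (dirDeriv a f) := by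
  have h : ⁅dirDeriv a, dirDeriv b⁆ = 0 := derivation_ext fun k => by
    simp [Derivation.commutator_apply, dirDeriv_X, derivation_C]
  have h2 := congrArg (fun D => D f) h
  simpa [Derivation.commutator_apply, sub_eq_zero] using h2

theorem totalDegree_pderiv_le {κ : Type} {d : ℕ} {f : MvPolynomial κ ℝ}
    (hf : f.totalDegree ≤ d + 1) (k : κ) : (pderiv k f).totalDegree ≤ d := by
  classical
  refine Finset.sup_le fun s hs => ?_
  rw [mem_support_iff, coeff_pderiv] at hs
  have h1 : s + Finsupp.single k 1 ∈ f.support := mem_support_iff.2 (left_ne_zero_of_mul hs)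
  have h2 := (le_totalDegree h1).trans hf
  rw [Finsupp.sum_add_index' (by simp) (by simp)] at h2
  simpa using h2

variable {κ : Type} [Fintype κ]

/-- The linear form with coefficients `a`. -/
noncomputable def linForm (a : κ → ℝ) : MvPolynomial κ ℝ := ∑ k, C (a k) * X k

/-- The formal adjoint of `dirDeriv a` for the standard Gaussian law. -/
noncomputable def dirAdjoint (a : κ → ℝ) : Module.End ℝ (MvPolynomial κ ℝ) :=
  LinearMap.mulLeft ℝ (linForm a) - (dirDeriv a).toLinearMap

theorem dirAdjoint_apply (a : κ → ℝ) (g : MvPolynomial κ ℝ) :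
    dirAdjoint a g = linForm a * g - dirDeriv a g := rfl

theorem dirDeriv_linForm (a b : κ → ℝ) : dirDeriv a (linForm b) = C (b ⬝ᵥ a) := by
  simp only [linForm, map_sum, Derivation.leibniz, dirDeriv_X, derivation_C, smul_eq_mul, mul_zero,
    add_zero, dotProduct, map_mul]

/-- The canonical commutation relation between annihilation and creation operators, from which all
later commutators follow. -/
theorem dirDeriv_dirAdjoint (a b : κ → ℝ) (g : MvPolynomial κ ℝ) :
    dirDeriv a (dirAdjoint b g) = (b ⬝ᵥ a) • g + dirAdjoint b (dirDeriv a g) := by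
  simp only [dirAdjoint_apply, map_sub, Derivation.leibniz, dirDeriv_linForm, smul_eq_mul,
    dirDeriv_comm a b, smul_eq_C_mul]
  ring

theorem dirAdjoint_comm (a b : κ → ℝ) (g : MvPolynomial κ ℝ) :
    dirAdjoint a (dirAdjoint b g) = dirAdjoint b (dirAdjoint a g) := by
  simp only [dirAdjoint_apply, map_sub, Derivation.leibniz, dirDeriv_linForm, smul_eq_mul,
    dirDeriv_comm a b, dotProduct_comm a b]
  ring

theorem dirDeriv_eq_sum (a : κ → ℝ) (f : MvPolynomial κ ℝ) :
    dirDeriv a f = ∑ k, a k • pderiv k f := by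
  classical
  induction f using MvPolynomial.induction_on with
  | C c => simp [derivation_C]
  | add f g hf hg => simp only [map_add, hf, hg, smul_add, Finset.sum_add_distrib]
  | mul_X f l hf =>
    simp only [Derivation.leibniz, hf, dirDeriv_X, pderiv_X, smul_eq_mul, smul_add,
      Finset.sum_add_distrib, Finset.mul_sum]
    congr 1
    · rw [Finset.sum_eq_single l]
      · simp [smul_eq_C_mul, mul_comm]
      · intro k _ hk
        simp [hk.symm]
      · simp
    · simp only [mul_smul_comm]

/-- The chain rule for linear substitutions. -/
theorem dirDeriv_aeval_linForm (b : κ → ℝ) (R : κ → κ → ℝ) (f : MvPolynomial κ ℝ) :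
    dirDeriv b (aeval (fun k => linForm (R k)) f) =
      ∑ l, (R l ⬝ᵥ b) • aeval (fun k => linForm (R k)) (pderiv l f) := by
  classical
  induction f using MvPolynomial.induction_on with
  | C c => simp [derivation_C]
  | add f g hf hg => simp only [map_add, hf, hg, smul_add, Finset.sum_add_distrib]
  | mul_X f l hf =>
    simp only [map_mul, Derivation.leibniz, hf, aeval_X, dirDeriv_linForm, pderiv_X, smul_eq_mul,
      smul_add, Finset.sum_add_distrib, Finset.mul_sum, map_add]
    congr 1
    · rw [Finset.sum_eq_single l]
      · simp [smul_eq_C_mul, mul_comm]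
      · intro k _ hk
        simp [hk.symm]
      · simp
    · simp only [mul_smul_comm]

/-- A linear functional on polynomials that satisfies the Gaussian integration by parts formula. -/
structure IsGaussianFunctional (E : MvPolynomial κ ℝ →ₗ[ℝ] ℝ) : Prop where
  map_one : E 1 = 1
  map_X_mul : ∀ k f, E (X k * f) = E (pderiv k f)

namespace IsGaussianFunctional

variable {E : MvPolynomial κ ℝ →ₗ[ℝ] ℝ}

theorem map_linForm_mul (hE : IsGaussianFunctional E) (a : κ → ℝ) (f : MvPolynomial κ ℝ) :
    E (linForm a * f) = E (dirDeriv a f) := by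
  simp only [linForm, Finset.sum_mul, map_sum, dirDeriv_eq_sum, mul_assoc]
  simp only [← smul_eq_C_mul, map_smul, hE.map_X_mul]

/-- Integration by parts differentiates both factors of g * f; the subtracted derivative in
`dirAdjoint` cancels the term that hits g. -/
theorem map_dirAdjoint_mul (hE : IsGaussianFunctional E) (a : κ → ℝ) (g f : MvPolynomial κ ℝ) :
    E (dirAdjoint a g * f) = E (g * dirDeriv a f) := by
  rw [dirAdjoint_apply, sub_mul, map_sub, mul_assoc, hE.map_linForm_mul, Derivation.leibniz,
    map_add, smul_eq_mul, smul_eq_mul, mul_comm f]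
  ring

/-- Integration by parts for the image of the standard Gaussian law under the linear map with
rows `R k`. -/
theorem map_aeval_X_mul (hE : IsGaussianFunctional E) (R : κ → κ → ℝ) (k : κ)
    (f : MvPolynomial κ ℝ) :
    E (aeval (fun k => linForm (R k)) (X k * f)) =
      ∑ l, (R l ⬝ᵥ R k) * E (aeval (fun k => linForm (R k)) (pderiv l f)) := by
  rw [map_mul, aeval_X, hE.map_linForm_mul, dirDeriv_aeval_linForm]
  simp

end IsGaussianFunctional

end Wick

/-! ### The coupling operators and the kernel of the planted law -/

section Regression

open MvPolynomial

variable {n p : ℕ}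

/-- The unit vector of the response `i`. -/
def responseVec (i : Fin n) : DataIndex n p → ℝ := Sum.elim 0 (Pi.single i 1)

/-- The vector `a` placed in the row `i` of the design matrix. -/
def designVec (a : Fin p → ℝ) (i : Fin n) : DataIndex n p → ℝ :=
  Sum.elim (fun q => if q.1 = i then a q.2 else 0) 0

theorem responseVec_dotProduct_responseVec (i j : Fin n) :
    (responseVec i : DataIndex n p → ℝ) ⬝ᵥ responseVec j = if i = j then 1 else 0 := by
  simp [responseVec, dotProduct, Pi.single_apply, eq_comm]

theorem responseVec_dotProduct_designVec (a : Fin p → ℝ) (i j : Fin n) :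
    responseVec i ⬝ᵥ designVec a j = 0 := by
  simp [responseVec, designVec, dotProduct]

theorem designVec_dotProduct_responseVec (a : Fin p → ℝ) (i j : Fin n) :
    designVec a j ⬝ᵥ responseVec i = 0 := by
  simp [responseVec, designVec, dotProduct]

theorem designVec_dotProduct_designVec (a b : Fin p → ℝ) (i j : Fin n) :
    designVec a i ⬝ᵥ designVec b j = if i = j then a ⬝ᵥ b else 0 := by
  simp only [designVec, dotProduct, Fintype.sum_sum_type, Sum.elim_inl, Sum.elim_inr,
    Fintype.sum_prod_type, Pi.zero_apply, mul_zero, Finset.sum_const_zero, add_zero, mul_ite,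
    ite_mul, zero_mul]
  rw [Finset.sum_eq_single i]
  · by_cases h : i = j <;> simp [h]
  · intro l _ hl
    simp [hl]
  · simp

/-- The differential operator whose exponential turns the null into the planted law. -/
noncomputable def couplingDeriv (a : Fin p → ℝ) : Module.End ℝ (MvPolynomial (DataIndex n p) ℝ) :=
  ∑ i, (dirDeriv (responseVec i)).toLinearMap ∘ₗ (dirDeriv (designVec a i)).toLinearMap

/-- The formal adjoint of `couplingDeriv a` for the standard Gaussian law. -/
noncomputable def couplingAdjoint (a : Fin p → ℝ) :
    Module.End ℝ (MvPolynomial (DataIndex n p) ℝ) :=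
  ∑ i, dirAdjoint (responseVec i) ∘ₗ dirAdjoint (designVec a i)

/-- The number operator that arises from commuting `couplingDeriv a` and `couplingAdjoint b`. -/
noncomputable def couplingNumber (a b : Fin p → ℝ) :
    Module.End ℝ (MvPolynomial (DataIndex n p) ℝ) :=
  ∑ i, ((a ⬝ᵥ b) • (dirAdjoint (responseVec i) ∘ₗ (dirDeriv (responseVec i)).toLinearMap) +
    dirAdjoint (designVec b i) ∘ₗ (dirDeriv (designVec a i)).toLinearMap)

theorem couplingDeriv_apply (a : Fin p → ℝ) (f : MvPolynomial (DataIndex n p) ℝ) :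
    couplingDeriv a f = ∑ i, dirDeriv (responseVec i) (dirDeriv (designVec a i) f) := by
  simp [couplingDeriv]

theorem couplingAdjoint_apply (a : Fin p → ℝ) (f : MvPolynomial (DataIndex n p) ℝ) :
    couplingAdjoint a f = ∑ i, dirAdjoint (responseVec i) (dirAdjoint (designVec a i) f) := by
  simp [couplingAdjoint]

theorem couplingNumber_apply (a b : Fin p → ℝ) (f : MvPolynomial (DataIndex n p) ℝ) :
    couplingNumber a b f = ∑ i, ((a ⬝ᵥ b) • dirAdjoint (responseVec i) (dirDeriv (responseVec i) f)
      + dirAdjoint (designVec b i) (dirDeriv (designVec a i) f)) := by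
  simp [couplingNumber]

theorem couplingDeriv_one (a : Fin p → ℝ) :
    couplingDeriv a (1 : MvPolynomial (DataIndex n p) ℝ) = 0 := by
  simp [couplingDeriv_apply]

theorem couplingNumber_one (a b : Fin p → ℝ) :
    couplingNumber a b (1 : MvPolynomial (DataIndex n p) ℝ) = 0 := by
  simp [couplingNumber_apply]

/-- Only equal rows fail to commute. Each of the n rows contributes the scalar a ⬝ᵥ b and its part
of the number operator. -/
theorem couplingDeriv_couplingAdjoint (a b : Fin p → ℝ) (g : MvPolynomial (DataIndex n p) ℝ) :
    couplingDeriv a (couplingAdjoint b g) =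
      couplingAdjoint b (couplingDeriv a g) + (n * (a ⬝ᵥ b)) • g + couplingNumber a b g := by
  have key : ∀ i j : Fin n, dirDeriv (responseVec i) (dirDeriv (designVec a i)
      (dirAdjoint (responseVec j) (dirAdjoint (designVec b j) g))) =
      dirAdjoint (responseVec j) (dirAdjoint (designVec b j)
        (dirDeriv (responseVec i) (dirDeriv (designVec a i) g))) +
      if j = i then (a ⬝ᵥ b) • g + ((a ⬝ᵥ b) • dirAdjoint (responseVec i)
        (dirDeriv (responseVec i) g) + dirAdjoint (designVec b i) (dirDeriv (designVec a i) g))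
        else 0 := by
    intro i j
    simp only [dirDeriv_dirAdjoint, responseVec_dotProduct_designVec, zero_smul, zero_add,
      designVec_dotProduct_designVec, designVec_dotProduct_responseVec, map_add,
      responseVec_dotProduct_responseVec, Derivation.map_smul, map_smul]
    by_cases h : j = i
    · subst h
      simp only [if_true, one_smul, dotProduct_comm b a, smul_add]
      ac_rfl
    · simp [h]
  simp only [couplingAdjoint_apply, couplingDeriv_apply, couplingNumber_apply, map_sum, key]
  simp only [Finset.sum_add_distrib, Finset.sum_ite_eq, Finset.mem_univ, if_true,
    Finset.sum_const, Finset.card_univ, Fintype.card_fin]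
  rw [mul_smul, Nat.cast_smul_eq_nsmul]
  rw [Finset.sum_comm]
  simp only [add_assoc]

/-- The coupling adjoint creates one response and one design excitation; each raises the number
operator by a ⬝ᵥ b, hence the factor 2. -/
theorem couplingNumber_couplingAdjoint (a b : Fin p → ℝ) (g : MvPolynomial (DataIndex n p) ℝ) :
    couplingNumber a b (couplingAdjoint b g) =
      couplingAdjoint b (couplingNumber a b g) + (2 * (a ⬝ᵥ b)) • couplingAdjoint b g := by
  have key : ∀ i j : Fin n, (a ⬝ᵥ b) • dirAdjoint (responseVec i) (dirDeriv (responseVec i)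
        (dirAdjoint (responseVec j) (dirAdjoint (designVec b j) g))) +
      dirAdjoint (designVec b i) (dirDeriv (designVec a i)
        (dirAdjoint (responseVec j) (dirAdjoint (designVec b j) g))) =
      dirAdjoint (responseVec j) (dirAdjoint (designVec b j)
        ((a ⬝ᵥ b) • dirAdjoint (responseVec i) (dirDeriv (responseVec i) g) +
          dirAdjoint (designVec b i) (dirDeriv (designVec a i) g))) +
      if j = i then (2 * (a ⬝ᵥ b)) • dirAdjoint (responseVec i) (dirAdjoint (designVec b i) g)
        else 0 := by
    intro i j
    simp only [dirDeriv_dirAdjoint, responseVec_dotProduct_designVec, zero_smul, zero_add,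
      designVec_dotProduct_designVec, designVec_dotProduct_responseVec, map_add,
      responseVec_dotProduct_responseVec, map_smul]
    simp only [dirAdjoint_comm (responseVec i) (responseVec j),
      dirAdjoint_comm (responseVec i) (designVec b j),
      dirAdjoint_comm (designVec b i) (responseVec j),
      dirAdjoint_comm (designVec b i) (designVec b j)]
    by_cases h : j = i
    · subst h
      simp only [if_true, one_smul, dotProduct_comm b a, two_mul, add_smul, smul_add,
        dirAdjoint_comm (designVec b j) (responseVec j)]
      generalize (a ⬝ᵥ b) • dirAdjoint (responseVec j) (dirAdjoint (designVec b j) g) = x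
      generalize (a ⬝ᵥ b) • dirAdjoint (responseVec j) (dirAdjoint (responseVec j) _) = y
      generalize dirAdjoint (responseVec j) _ = z
      abel
    · simp [h]
  simp only [couplingAdjoint_apply, couplingNumber_apply, map_sum, Finset.smul_sum,
    ← Finset.sum_add_distrib, key]
  simp only [Finset.sum_add_distrib, Finset.sum_ite_eq, Finset.mem_univ, if_true]
  rw [Finset.sum_comm]

theorem couplingNumber_pow_one (a b : Fin p → ℝ) (l : ℕ) :
    couplingNumber a b ((couplingAdjoint b ^ l) (1 : MvPolynomial (DataIndex n p) ℝ)) =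
      (2 * l * (a ⬝ᵥ b)) • (couplingAdjoint b ^ l) 1 := by
  induction l with
  | zero => simp [couplingNumber_one]
  | succ l ih =>
    rw [pow_succ', Module.End.mul_apply, couplingNumber_couplingAdjoint, ih, map_smul, ← add_smul]
    push_cast
    ring_nf

/-- Moving the derivative through one adjoint at a time adds n + 2l at stage l, and these sum to (l
+ 1)(n + l). Lowering a power of the adjoint for b thus costs only a scalar, even though the
derivative is that of a. -/
theorem couplingDeriv_pow_one (a b : Fin p → ℝ) (l : ℕ) :
    couplingDeriv a ((couplingAdjoint b ^ (l + 1)) (1 : MvPolynomial (DataIndex n p) ℝ)) =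
      ((l + 1) * (n + l) * (a ⬝ᵥ b)) • (couplingAdjoint b ^ l) 1 := by
  induction l with
  | zero =>
    simp [couplingDeriv_couplingAdjoint, couplingDeriv_one, couplingNumber_one]
  | succ l ih =>
    rw [pow_succ', Module.End.mul_apply, couplingDeriv_couplingAdjoint, ih, map_smul,
      couplingNumber_pow_one, ← Module.End.mul_apply, ← pow_succ', ← add_smul, ← add_smul]
    push_cast
    ring_nf

theorem couplingDeriv_pow_couplingAdjoint_pow_one (a b : Fin p → ℝ) (l m : ℕ) :
    (couplingDeriv a ^ m) ((couplingAdjoint b ^ (l + m)) (1 : MvPolynomial (DataIndex n p) ℝ)) =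
      (∏ j ∈ Finset.range m, ((l + j + 1) * (n + (l + j)) * (a ⬝ᵥ b))) •
        (couplingAdjoint b ^ l) 1 := by
  induction m with
  | zero => simp
  | succ m ih =>
    rw [pow_succ, Module.End.mul_apply, ← add_assoc, couplingDeriv_pow_one, map_smul, ih, smul_smul,
      Finset.prod_range_succ, mul_comm]
    push_cast
    rfl

/-- The coefficients of the polynomial `(1 - t)⁻ⁿ`. -/
noncomputable def negBinomCoeff (n m : ℕ) : ℝ := (∏ j ∈ Finset.range m, ((n : ℝ) + j)) / m.factorial

/-- The kernel that represents the planted expectation of polynomials of degree at most `2M + 1`. -/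
noncomputable def plantedKernel (n : ℕ) (M : ℕ) (a : Fin p → ℝ) :
    MvPolynomial (DataIndex n p) ℝ :=
  ∑ m ∈ Finset.range (M + 1), (m.factorial : ℝ)⁻¹ • (couplingAdjoint a ^ m) 1

theorem IsGaussianFunctional.map_couplingAdjoint_pow_mul
    {E : MvPolynomial (DataIndex n p) ℝ →ₗ[ℝ] ℝ} (hE : IsGaussianFunctional E)
    (a : Fin p → ℝ) (m : ℕ) (g f : MvPolynomial (DataIndex n p) ℝ) :
    E ((couplingAdjoint a ^ m) g * f) = E (g * (couplingDeriv a ^ m) f) := by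
  induction m generalizing f with
  | zero => simp
  | succ m ih =>
    rw [pow_succ', Module.End.mul_apply, couplingAdjoint_apply, Finset.sum_mul, map_sum, pow_succ,
      Module.End.mul_apply, ← ih, couplingDeriv_apply, Finset.mul_sum, map_sum]
    refine Finset.sum_congr rfl fun i _ => ?_
    rw [hE.map_dirAdjoint_mul, hE.map_dirAdjoint_mul, dirDeriv_comm]

/-- Moving all adjoints to the other side as derivatives lowers the other power step by step. When
the powers differ, a surplus derivative reaches the constant 1 and kills it. -/
theorem IsGaussianFunctional.map_couplingAdjoint_pow_mul_pow
    {E : MvPolynomial (DataIndex n p) ℝ →ₗ[ℝ] ℝ} (hE : IsGaussianFunctional E)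
    (a b : Fin p → ℝ) (m l : ℕ) :
    E ((couplingAdjoint a ^ m) 1 * (couplingAdjoint b ^ l) 1) =
      if m = l then ∏ j ∈ Finset.range m, (((j : ℝ) + 1) * (n + j) * (a ⬝ᵥ b)) else 0 := by
  -- Quantified over both vectors, so that the opposite order of the powers follows by exchanging
  -- the factors.
  have hlt : ∀ (a b : Fin p → ℝ) (m l : ℕ), l < m →
      E ((couplingAdjoint a ^ m) 1 * (couplingAdjoint b ^ l) 1) = 0 := by
    intro a b m l h
    obtain ⟨d, rfl⟩ := Nat.exists_eq_add_of_lt h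
    have h1 := couplingDeriv_pow_couplingAdjoint_pow_one (n := n) a b 0 l
    rw [hE.map_couplingAdjoint_pow_mul, show l + d + 1 = (d + 1) + l by ring, pow_add,
      Module.End.mul_apply]
    rw [zero_add] at h1
    rw [h1, map_smul, pow_succ, Module.End.mul_apply, pow_zero, Module.End.one_apply,
      couplingDeriv_one]
    simp
  rcases lt_trichotomy m l with h | rfl | h
  · rw [mul_comm, hlt b a l m h, if_neg h.ne]
  · have h1 := couplingDeriv_pow_couplingAdjoint_pow_one (n := n) a b 0 m
    rw [zero_add] at h1
    rw [hE.map_couplingAdjoint_pow_mul, h1]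
    simp [hE.map_one]
  · rw [hlt a b m l h, if_neg h.ne']

theorem IsGaussianFunctional.map_plantedKernel_mul
    {E : MvPolynomial (DataIndex n p) ℝ →ₗ[ℝ] ℝ} (hE : IsGaussianFunctional E)
    (M : ℕ) (a b : Fin p → ℝ) :
    E (plantedKernel n M a * plantedKernel n M b) =
      ∑ m ∈ Finset.range (M + 1), negBinomCoeff n m * (a ⬝ᵥ b) ^ m := by
  simp only [plantedKernel, Finset.sum_mul, Finset.mul_sum, map_sum, smul_mul_smul_comm, map_smul,
    hE.map_couplingAdjoint_pow_mul_pow]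
  refine Finset.sum_congr rfl fun m hm => ?_
  simp only [smul_eq_mul, mul_ite, mul_zero, Finset.sum_ite_eq', hm, if_true]
  have hfac : ∏ j ∈ Finset.range m, ((j : ℝ) + 1) = m.factorial := by
    exact_mod_cast Finset.prod_range_add_one_eq_factorial m
  have h0 : (m.factorial : ℝ) ≠ 0 := by positivity
  rw [Finset.prod_mul_distrib, Finset.prod_mul_distrib, hfac, Finset.prod_const, Finset.card_range,
    negBinomCoeff]
  field_simp

/-! ### Representation of the planted expectation -/

/-- The row of the linear map which turns the null into the planted law. -/
noncomputable def plantedRow (c : ℝ) (a : Fin p → ℝ) : DataIndex n p → DataIndex n p → ℝ :=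
  Sum.elim (fun q => designVec (Pi.single q.2 1) q.1) fun i => designVec a i + c • responseVec i

/-- The off-diagonal part of the planted covariance. -/
def crossCov (a : Fin p → ℝ) : DataIndex n p → DataIndex n p → ℝ :=
  Sum.elim (fun q => a q.2 • responseVec q.1) fun i => designVec a i

/-- The Gram matrix of the rows is the planted covariance. The normalization makes every response
have variance 1, so that only the cross terms differ from the identity. -/
theorem plantedRow_dotProduct {c : ℝ} {a : Fin p → ℝ} (h : a ⬝ᵥ a + c ^ 2 = 1)
    (k l : DataIndex n p) :
    plantedRow c a l ⬝ᵥ plantedRow c a k = (if l = k then 1 else 0) + crossCov a k l := by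
  rcases k with ⟨i, j⟩ | i <;> rcases l with ⟨i', j'⟩ | i'
  · have h1 : crossCov a (Sum.inl (i, j)) (Sum.inl (i', j')) = 0 := by
      simp [crossCov, responseVec]
    rw [h1, plantedRow, Sum.elim_inl, Sum.elim_inl, designVec_dotProduct_designVec]
    by_cases h1 : i' = i <;> by_cases h2 : j' = j <;> simp [h1, h2]
  · have h1 : crossCov a (Sum.inl (i, j)) (Sum.inr i') = if i' = i then a j else 0 := by
      simp [crossCov, responseVec, Pi.single_apply]
    rw [h1, plantedRow, Sum.elim_inl, Sum.elim_inr, add_dotProduct, smul_dotProduct,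
      designVec_dotProduct_designVec, responseVec_dotProduct_designVec]
    simp
  · have h1 : crossCov a (Sum.inr i) (Sum.inl (i', j')) = if i' = i then a j' else 0 := by
      simp [crossCov, designVec]
    rw [h1, plantedRow, Sum.elim_inl, Sum.elim_inr, dotProduct_add, dotProduct_smul,
      designVec_dotProduct_designVec, designVec_dotProduct_responseVec]
    simp
  · have h1 : crossCov a (Sum.inr i) (Sum.inr i') = 0 := by
      simp [crossCov, designVec]
    rw [h1, plantedRow, Sum.elim_inr, Sum.elim_inr, dotProduct_add, dotProduct_smul,
      add_dotProduct, add_dotProduct, smul_dotProduct, smul_dotProduct,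
      designVec_dotProduct_designVec, designVec_dotProduct_responseVec,
      responseVec_dotProduct_designVec, responseVec_dotProduct_responseVec]
    by_cases h2 : i' = i
    · simp only [h2, if_true, smul_eq_mul]
      linarith
    · simp [h2]

/-- The commutator of a second-order operator with a coordinate is a first-order one: the derivative
along the k-th row of the off-diagonal covariance. -/
theorem couplingDeriv_X_mul (a : Fin p → ℝ) (k : DataIndex n p)
    (f : MvPolynomial (DataIndex n p) ℝ) :
    couplingDeriv a (X k * f) = X k * couplingDeriv a f + dirDeriv (crossCov a k) f := by
  have h1 : dirDeriv (crossCov a k) f = ∑ i, (designVec a i k • dirDeriv (responseVec i) f +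
      responseVec i k • dirDeriv (designVec a i) f) := by
    simp only [dirDeriv_eq_sum, Finset.smul_sum, ← Finset.sum_add_distrib, smul_smul, ← add_smul]
    rw [Finset.sum_comm]
    simp only [← Finset.sum_smul]
    refine Finset.sum_congr rfl fun l _ => ?_
    congr 1
    rcases k with ⟨i, j⟩ | i <;> rcases l with ⟨i', j'⟩ | i' <;>
      simp [crossCov, designVec, responseVec, Pi.single_apply, eq_comm]
  rw [h1]
  simp only [couplingDeriv_apply, Derivation.leibniz, dirDeriv_X, map_add, derivation_C,
    smul_eq_mul, mul_zero, smul_eq_C_mul, Finset.mul_sum, ← Finset.sum_add_distrib]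
  refine Finset.sum_congr rfl fun i _ => ?_
  ring

theorem couplingDeriv_dirDeriv (a : Fin p → ℝ) (v : DataIndex n p → ℝ)
    (f : MvPolynomial (DataIndex n p) ℝ) :
    couplingDeriv a (dirDeriv v f) = dirDeriv v (couplingDeriv a f) := by
  simp only [couplingDeriv_apply, map_sum, dirDeriv_comm v]

theorem couplingDeriv_pow_dirDeriv (a : Fin p → ℝ) (v : DataIndex n p → ℝ) (m : ℕ)
    (f : MvPolynomial (DataIndex n p) ℝ) :
    (couplingDeriv a ^ m) (dirDeriv v f) = dirDeriv v ((couplingDeriv a ^ m) f) := by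
  induction m generalizing f with
  | zero => rfl
  | succ m ih => rw [pow_succ, Module.End.mul_apply, couplingDeriv_dirDeriv, ih,
      ← Module.End.mul_apply]

/-- The commutator with one factor commutes with the remaining factors, so the m + 1 positions
contribute equally. -/
theorem couplingDeriv_pow_succ_X_mul (a : Fin p → ℝ) (k : DataIndex n p) (m : ℕ)
    (f : MvPolynomial (DataIndex n p) ℝ) :
    (couplingDeriv a ^ (m + 1)) (X k * f) =
      X k * (couplingDeriv a ^ (m + 1)) f +
        ((m : ℝ) + 1) • (couplingDeriv a ^ m) (dirDeriv (crossCov a k) f) := by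
  induction m with
  | zero => simp [couplingDeriv_X_mul]
  | succ m ih =>
    rw [pow_succ', Module.End.mul_apply, ih, map_add, couplingDeriv_X_mul, map_smul,
      ← Module.End.mul_apply, ← Module.End.mul_apply, ← pow_succ', ← pow_succ',
      couplingDeriv_pow_dirDeriv]
    push_cast
    module

/-- The expectation of a polynomial of degree at most `2M + 1` under the planted law is the
truncated exponential of `couplingDeriv`. -/
theorem IsGaussianFunctional.map_aeval_plantedRow
    {E : MvPolynomial (DataIndex n p) ℝ →ₗ[ℝ] ℝ} (hE : IsGaussianFunctional E)
    {c : ℝ} {a : Fin p → ℝ} (h : a ⬝ᵥ a + c ^ 2 = 1) (M : ℕ)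
    (f : MvPolynomial (DataIndex n p) ℝ) (hf : f.totalDegree ≤ 2 * M + 1) :
    E (aeval (fun k => linForm (plantedRow c a k)) f) =
      ∑ m ∈ Finset.range (M + 1), (m.factorial : ℝ)⁻¹ * E ((couplingDeriv a ^ m) f) := by
  classical
  set S := aeval (R := ℝ) fun k => linForm (plantedRow (n := n) c a k) with hS
  -- the two recursions
  have hpl : ∀ k g, E (S (X k * g)) = E (S (pderiv k g)) + E (S (dirDeriv (crossCov a k) g)) := by
    intro k g
    rw [hS, hE.map_aeval_X_mul, dirDeriv_eq_sum]
    simp only [plantedRow_dotProduct h, add_mul, Finset.sum_add_distrib, map_sum, map_smul,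
      smul_eq_mul, ite_mul, one_mul, zero_mul, Finset.sum_ite_eq', Finset.mem_univ, if_true]
  have hpd : ∀ (k : DataIndex n p) (m : ℕ) (g : MvPolynomial (DataIndex n p) ℝ),
      (couplingDeriv a ^ m) (pderiv k g) = pderiv k ((couplingDeriv a ^ m) g) := by
    intro k m g
    have h1 : ∀ g : MvPolynomial (DataIndex n p) ℝ, dirDeriv (Pi.single k 1) g = pderiv k g := by
      intro g
      rw [dirDeriv_eq_sum, Finset.sum_eq_single k]
      · simp
      · intro l _ hl
        simp [hl]
      · simp
    rw [← h1, couplingDeriv_pow_dirDeriv, h1]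
  -- The commutator factor m + 1 turns 1/(m+1)! into 1/m! and shifts the index, so the coupling sum
  -- is one term shorter than the other sums.
  have hser : ∀ (M : ℕ) (k : DataIndex n p) (g : MvPolynomial (DataIndex n p) ℝ),
      ∑ m ∈ Finset.range (M + 1), (m.factorial : ℝ)⁻¹ * E ((couplingDeriv a ^ m) (X k * g)) =
      ∑ m ∈ Finset.range (M + 1), (m.factorial : ℝ)⁻¹ * E ((couplingDeriv a ^ m) (pderiv k g)) +
      ∑ m ∈ Finset.range M, (m.factorial : ℝ)⁻¹ *
        E ((couplingDeriv a ^ m) (dirDeriv (crossCov a k) g)) := by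
    intro M k g
    rw [Finset.sum_range_succ', Finset.sum_range_succ'
      (fun m => (m.factorial : ℝ)⁻¹ * E ((couplingDeriv a ^ m) (pderiv k g)))]
    simp only [couplingDeriv_pow_succ_X_mul, map_add, hE.map_X_mul, hpd, mul_add,
      Finset.sum_add_distrib, map_smul, smul_eq_mul, pow_zero, Module.End.one_apply]
    have : ∀ m : ℕ, (((m + 1).factorial : ℝ))⁻¹ * (((m : ℝ) + 1) *
        E ((couplingDeriv a ^ m) (dirDeriv (crossCov a k) g))) = (m.factorial : ℝ)⁻¹ *
        E ((couplingDeriv a ^ m) (dirDeriv (crossCov a k) g)) := by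
      intro m
      rw [Nat.factorial_succ]
      push_cast
      field_simp
    simp only [this]
    ring
  have hC : ∀ (x : ℝ) (M : ℕ), E (S (C x)) =
      ∑ m ∈ Finset.range (M + 1), (m.factorial : ℝ)⁻¹ * E ((couplingDeriv a ^ m) (C x)) := by
    intro x M
    rw [Finset.sum_range_succ', Finset.sum_eq_zero]
    · simp
    · intro m _
      rw [pow_succ, Module.End.mul_apply, couplingDeriv_apply]
      simp [derivation_C]
  -- reduction to monomials
  have hred : ∀ (d M : ℕ), (∀ (k : DataIndex n p) (g : MvPolynomial (DataIndex n p) ℝ),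
      g.totalDegree + 1 ≤ d → E (S (X k * g)) = ∑ m ∈ Finset.range (M + 1),
        (m.factorial : ℝ)⁻¹ * E ((couplingDeriv a ^ m) (X k * g))) →
      ∀ f : MvPolynomial (DataIndex n p) ℝ, f.totalDegree ≤ d → E (S f) =
        ∑ m ∈ Finset.range (M + 1), (m.factorial : ℝ)⁻¹ * E ((couplingDeriv a ^ m) f) := by
    intro d M hX f hf
    rw [f.as_sum]
    simp only [map_sum, Finset.mul_sum]
    rw [Finset.sum_comm]
    refine Finset.sum_congr rfl fun s hs => ?_
    by_cases hs0 : s = 0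
    · rw [hs0]
      exact hC _ _
    · obtain ⟨k, hk⟩ := Finsupp.ne_iff.1 hs0
      have hle : Finsupp.single k 1 ≤ s := by
        rw [Finsupp.single_le_iff]
        exact Nat.one_le_iff_ne_zero.2 hk
      have hmon : monomial s (coeff s f) =
          X k * monomial (s - Finsupp.single k 1) (coeff s f) := by
        rw [X, monomial_mul, one_mul, add_tsub_cancel_of_le hle]
      rw [hmon]
      refine hX k _ ?_
      have h1 := (le_totalDegree hs).trans hf
      conv at h1 => lhs; rw [← add_tsub_cancel_of_le hle,
        Finsupp.sum_add_index' (by simp) (by simp)]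
      refine le_trans ?_ h1
      have h2 := totalDegree_monomial_le (s - Finsupp.single k 1) (coeff s f)
      rw [Finsupp.sum_single_index rfl, add_comm]
      exact Nat.add_le_add_left h2 1
  have hdir : ∀ (v : DataIndex n p → ℝ) (d : ℕ) (g : MvPolynomial (DataIndex n p) ℝ),
      g.totalDegree ≤ d + 1 → (dirDeriv v g).totalDegree ≤ d := by
    intro v d g hg
    rw [dirDeriv_eq_sum]
    exact totalDegree_finsetSum_le fun l _ =>
      (totalDegree_smul_le _ _).trans (totalDegree_pderiv_le hg l)
  -- The truncation order M varies in the induction: the coupling term loses two degrees and one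
  -- order, which preserves d ≤ 2M + 1.
  have main : ∀ (d : ℕ) (f : MvPolynomial (DataIndex n p) ℝ) (M : ℕ), f.totalDegree ≤ d →
      d ≤ 2 * M + 1 → E (S f) =
        ∑ m ∈ Finset.range (M + 1), (m.factorial : ℝ)⁻¹ * E ((couplingDeriv a ^ m) f) := by
    intro d
    induction d using Nat.strong_induction_on with
    | _ d ih =>
      intro f M hfd hd
      refine hred d M (fun k g hg => ?_) f hfd
      rw [hpl, hser]
      -- M = 0 is possible only here, where g is constant and all derivatives vanish.
      by_cases hd1 : d ≤ 1
      · obtain ⟨x, rfl⟩ : ∃ x, g = C x := ⟨_, totalDegree_eq_zero_iff_eq_C.1 (by omega)⟩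
        simp [derivation_C]
      · obtain ⟨M, rfl⟩ : ∃ M', M = M' + 1 := ⟨M - 1, by omega⟩
        rw [ih (d - 2) (by omega) _ M (hdir _ (d - 2) g (by omega)) (by omega),
          ih (d - 2) (by omega) _ (M + 1) (totalDegree_pderiv_le (by omega) k) (by omega)]
  exact main _ f M hf le_rfl

/-- The kernel represents the planted expectation. -/
theorem IsGaussianFunctional.map_plantedKernel_mul_eq_map_aeval
    {E : MvPolynomial (DataIndex n p) ℝ →ₗ[ℝ] ℝ} (hE : IsGaussianFunctional E)
    {c : ℝ} {a : Fin p → ℝ} (h : a ⬝ᵥ a + c ^ 2 = 1) (M : ℕ)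
    (f : MvPolynomial (DataIndex n p) ℝ) (hf : f.totalDegree ≤ 2 * M + 1) :
    E (plantedKernel n M a * f) = E (aeval (fun k => linForm (plantedRow c a k)) f) := by
  rw [hE.map_aeval_plantedRow h M f hf, plantedKernel, Finset.sum_mul, map_sum]
  refine Finset.sum_congr rfl fun m _ => ?_
  rw [smul_mul_assoc, map_smul, hE.map_couplingAdjoint_pow_mul, one_mul, smul_eq_mul]

attribute [irreducible] plantedKernel

end Regression

/-! ### Moments of the standard Gaussian law -/

section GaussianPolynomials

open MvPolynomial

theorem integrable_pow_gaussianReal (m : ℕ) :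
    Integrable (fun x : ℝ => x ^ m) (gaussianReal 0 1) := by
  have h := (memLp_id_gaussianReal (μ := 0) (v := 1) m).integrable_norm_pow'
  refine h.mono' (by fun_prop) (Eventually.of_forall fun x => ?_)
  simp

/-- Integration by parts against the density, whose derivative is -x times itself. For m = 0 the
truncated exponent m - 1 is harmless because of the factor m. -/
theorem integral_pow_succ_gaussianReal (m : ℕ) :
    ∫ x, x ^ (m + 1) ∂(gaussianReal 0 1) = m * ∫ x, x ^ (m - 1) ∂(gaussianReal 0 1) := by
  have hint : ∀ m : ℕ, Integrable fun x : ℝ => x ^ m * gaussianPDFReal 0 1 x := by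
    intro m
    have h := integrable_pow_gaussianReal m
    rw [gaussianReal_of_var_ne_zero _ one_ne_zero, gaussianPDF_def,
      integrable_withDensity_iff_integrable_smul₀' (by fun_prop) (by simp)] at h
    refine h.congr (Eventually.of_forall fun x => ?_)
    simp [ENNReal.toReal_ofReal (gaussianPDFReal_nonneg 0 1 x), mul_comm]
  have hderiv : ∀ x : ℝ, HasDerivAt (gaussianPDFReal 0 1) (-x * gaussianPDFReal 0 1 x) x := by
    intro x
    simp only [gaussianPDFReal_def]
    have h1 : HasDerivAt (fun x : ℝ => -(x - 0) ^ 2 / (2 * ((1 : NNReal) : ℝ))) (-x) x := by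
      have := (((hasDerivAt_id x).sub_const 0).pow 2).neg.div_const (2 * ((1 : NNReal) : ℝ))
      convert! this using 1
      simp
      ring
    convert! (h1.exp.const_mul (√(2 * Real.pi * ((1 : NNReal) : ℝ)))⁻¹) using 1
    ring
  have key := integral_mul_deriv_eq_deriv_mul_of_integrable
    (u := fun x : ℝ => x ^ m) (u' := fun x => m * x ^ (m - 1)) (v := gaussianPDFReal 0 1)
    (v' := fun x => -x * gaussianPDFReal 0 1 x)
    (fun x _ => by simpa using hasDerivAt_pow m x) (fun x _ => hderiv x)
    ((hint (m + 1)).neg.congr (Eventually.of_forall fun x => by simp [pow_succ]; ring))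
    (((hint (m - 1)).const_mul m).congr (Eventually.of_forall fun x => by simp [mul_assoc]))
    (hint m)
  rw [integral_gaussianReal_eq_integral_smul one_ne_zero,
    integral_gaussianReal_eq_integral_smul one_ne_zero, ← integral_const_mul, ← neg_inj,
    ← integral_neg, ← integral_neg]
  rw [← integral_neg] at key
  convert! key using 2 <;> ext x
  · simp [pow_succ]; ring
  · simp; ring

instance {κ : Type} [Fintype κ] : IsProbabilityMeasure (gaussianEntries κ) := by
  unfold gaussianEntries; infer_instance

variable {κ : Type} [Fintype κ]

theorem measurable_eval_mvPolynomial (f : MvPolynomial κ ℝ) : Measurable fun x => eval x f := by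
  simp only [eval_eq']
  fun_prop

theorem integrable_eval_gaussianEntries (f : MvPolynomial κ ℝ) :
    Integrable (fun x => eval x f) (gaussianEntries κ) := by
  simp only [eval_eq']
  refine integrable_finsetSum _ fun s _ => Integrable.const_mul ?_ _
  exact Integrable.fintype_prod (f := fun k (x : ℝ) => x ^ s k)
    fun k => integrable_pow_gaussianReal (s k)

theorem memLp_eval_gaussianEntries (f : MvPolynomial κ ℝ) :
    MemLp (fun x => eval x f) 2 (gaussianEntries κ) := by
  rw [memLp_two_iff_integrable_sq (measurable_eval_mvPolynomial f).aestronglyMeasurable]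
  refine (integrable_eval_gaussianEntries (f ^ 2)).congr (Eventually.of_forall fun x => ?_)
  simp

/-- The expectation of polynomials in independent standard Gaussian variables. -/
noncomputable def gaussianExpectation (κ : Type) [Fintype κ] : MvPolynomial κ ℝ →ₗ[ℝ] ℝ where
  toFun f := ∫ x, eval x f ∂(gaussianEntries κ)
  map_add' f g := by
    simp only [map_add]
    exact integral_add (integrable_eval_gaussianEntries f) (integrable_eval_gaussianEntries g)
  map_smul' c f := by
    simp only [smul_eval, RingHom.id_apply, smul_eq_mul]
    exact integral_const_mul _ _

theorem gaussianExpectation_apply (f : MvPolynomial κ ℝ) :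
    gaussianExpectation κ f = ∫ x, eval x f ∂(gaussianEntries κ) := rfl

theorem gaussianExpectation_monomial (s : κ →₀ ℕ) (c : ℝ) :
    gaussianExpectation κ (monomial s c) = c * ∏ k, ∫ x, x ^ s k ∂(gaussianReal 0 1) := by
  rw [gaussianExpectation_apply]
  simp only [eval_monomial]
  rw [integral_const_mul, ← integral_fintype_prod_eq_prod (fun k (x : ℝ) => x ^ s k)]
  congr 2
  ext x
  rw [Finsupp.prod_fintype _ _ (by simp)]

theorem isGaussianFunctional_gaussianExpectation : IsGaussianFunctional (gaussianExpectation κ) where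
  map_one := by simp [gaussianExpectation_apply]
  map_X_mul k f := by
    classical
    induction f using MvPolynomial.induction_on' with
    | monomial s c =>
      rw [X, monomial_mul, one_mul, pderiv_monomial, gaussianExpectation_monomial,
        gaussianExpectation_monomial, ← Finset.mul_prod_erase _ _ (Finset.mem_univ k),
        ← Finset.mul_prod_erase _ _ (Finset.mem_univ k)]
      have h1 : (Finsupp.single k 1 + s : κ →₀ ℕ) k = s k + 1 := by simp [add_comm]
      have h2 : (s - Finsupp.single k 1 : κ →₀ ℕ) k = s k - 1 := by simp
      rw [h1, h2, integral_pow_succ_gaussianReal]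
      have h3 : ∀ l ∈ Finset.univ.erase k, (Finsupp.single k 1 + s : κ →₀ ℕ) l =
          (s - Finsupp.single k 1 : κ →₀ ℕ) l := by
        intro l hl
        have := Finset.ne_of_mem_erase hl
        simp [this.symm]
      rw [Finset.prod_congr rfl fun l hl => by rw [h3 l hl]]
      ring
    | add f g hf hg => simp only [mul_add, map_add, hf, hg]

end GaussianPolynomials

/-! ### Gaussian shifts as densities -/

section Density

open scoped ENNReal

/-- Both measures agree on boxes: there the indicator of the box splits into factors, and the
integral of a product is the product of the integrals. -/
theorem pi_withDensity_ofReal {ι : Type} [Fintype ι] (μ : ι → Measure ℝ)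
    [∀ i, SigmaFinite (μ i)] (f : ι → ℝ → ℝ) (hf : ∀ i, Integrable (f i) (μ i))
    (hf0 : ∀ i x, 0 ≤ f i x) :
    Measure.pi (fun i => (μ i).withDensity fun x => ENNReal.ofReal (f i x)) =
      (Measure.pi μ).withDensity fun x => ENNReal.ofReal (∏ i, f i (x i)) := by
  have hfin : ∀ i, IsFiniteMeasure ((μ i).withDensity fun x => ENNReal.ofReal (f i x)) :=
    fun i => isFiniteMeasure_withDensity_ofReal (hf i).2
  refine Measure.pi_eq fun s hs => ?_
  rw [withDensity_apply _ (MeasurableSet.univ_pi hs)]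
  have hind : ∀ i, Integrable ((s i).indicator (f i)) (μ i) := fun i => (hf i).indicator (hs i)
  have hind0 : ∀ i x, 0 ≤ (s i).indicator (f i) x := fun i x =>
    Set.indicator_nonneg (fun y _ => hf0 i y) x
  calc ∫⁻ x in Set.univ.pi s, ENNReal.ofReal (∏ i, f i (x i)) ∂Measure.pi μ
      = ∫⁻ x, ENNReal.ofReal (∏ i, (s i).indicator (f i) (x i)) ∂Measure.pi μ := by
        rw [← lintegral_indicator (MeasurableSet.univ_pi hs)]
        refine lintegral_congr fun x => ?_
        by_cases hx : x ∈ Set.univ.pi s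
        · rw [Set.indicator_of_mem hx]
          congr 1
          refine Finset.prod_congr rfl fun i _ => ?_
          rw [Set.indicator_of_mem (hx i (Set.mem_univ i))]
        · rw [Set.indicator_of_notMem hx]
          obtain ⟨i, hi⟩ : ∃ i, x i ∉ s i := by simpa [Set.mem_pi] using hx
          rw [Finset.prod_eq_zero (Finset.mem_univ i) (Set.indicator_of_notMem hi _)]
          simp
    _ = ENNReal.ofReal (∏ i, ∫ x, (s i).indicator (f i) x ∂(μ i)) := by
        rw [← integral_fintype_prod_eq_prod fun i => (s i).indicator (f i),
          ofReal_integral_eq_lintegral_ofReal (Integrable.fintype_prod hind)]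
        exact Eventually.of_forall fun x => Finset.prod_nonneg fun i _ => hind0 i _
    _ = ∏ i, (μ i).withDensity (fun x => ENNReal.ofReal (f i x)) (s i) := by
        rw [ENNReal.ofReal_prod_of_nonneg fun i _ => integral_nonneg (hind0 i)]
        refine Finset.prod_congr rfl fun i _ => ?_
        rw [ofReal_integral_eq_lintegral_ofReal (hind i) (Eventually.of_forall (hind0 i)),
          withDensity_apply _ (hs i), ← lintegral_indicator (hs i)]
        refine lintegral_congr fun x => ?_
        by_cases hx : x ∈ s i <;> simp [hx]

/-- The density of `N(z, 1)` with respect to `N(0, s²)`. -/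
noncomputable def responseDensity (s z y : ℝ) : ℝ :=
  s * Real.exp (-(y - z) ^ 2 / 2 + y ^ 2 / (2 * s ^ 2))

theorem responseDensity_nonneg {s : ℝ} (hs : 0 < s) (z y : ℝ) : 0 ≤ responseDensity s z y := by
  unfold responseDensity; positivity

theorem gaussianReal_eq_withDensity {s : ℝ} (hs : 0 < s) (z : ℝ) :
    gaussianReal z 1 = ((gaussianReal 0 1).map (s * ·)).withDensity
      fun y => ENNReal.ofReal (responseDensity s z y) := by
  have hv : (NNReal.mk (s ^ 2) (sq_nonneg s) * 1 : NNReal) ≠ 0 := by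
    rw [mul_one, ← NNReal.coe_ne_zero]
    simp [hs.ne']
  rw [gaussianReal_map_const_mul, gaussianReal_of_var_ne_zero _ one_ne_zero,
    gaussianReal_of_var_ne_zero _ hv, ← withDensity_mul _ (by fun_prop)
      (by unfold responseDensity; fun_prop)]
  congr 1
  ext y
  rw [Pi.mul_apply, gaussianPDF_def, gaussianPDF_def,
    ← ENNReal.ofReal_mul (gaussianPDFReal_nonneg _ _ _)]
  beta_reduce
  congr 1
  simp only [gaussianPDFReal_def, responseDensity, mul_one, mul_zero, sub_zero, NNReal.coe_mk,
    NNReal.coe_one]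
  rw [Real.sqrt_mul (x := 2 * Real.pi) (by positivity) (s ^ 2), Real.sqrt_sq hs.le]
  have h2 : (√(2 * Real.pi) * s)⁻¹ * Real.exp (-y ^ 2 / (2 * s ^ 2)) *
      (s * Real.exp (-(y - z) ^ 2 / 2 + y ^ 2 / (2 * s ^ 2))) =
      (√(2 * Real.pi))⁻¹ * (Real.exp (-y ^ 2 / (2 * s ^ 2)) *
        Real.exp (-(y - z) ^ 2 / 2 + y ^ 2 / (2 * s ^ 2))) := by
    field_simp
  rw [h2, ← Real.exp_add]
  congr 2
  ring

theorem integrable_responseDensity {s : ℝ} (hs : 0 < s) (z : ℝ) :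
    Integrable (responseDensity s z) ((gaussianReal 0 1).map (s * ·)) := by
  refine ⟨by unfold responseDensity; fun_prop, ?_⟩
  rw [hasFiniteIntegral_iff_ofReal (Eventually.of_forall (responseDensity_nonneg hs z))]
  have h := measure_univ (μ := gaussianReal z 1)
  rw [gaussianReal_eq_withDensity hs, withDensity_apply _ MeasurableSet.univ,
    Measure.restrict_univ] at h
  rw [h]
  exact ENNReal.one_lt_top

theorem map_add_gaussianEntries {ι : Type} [Fintype ι] {s : ℝ} (hs : 0 < s) (z : ι → ℝ) :
    (gaussianEntries ι).map (fun w i => z i + w i) =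
      ((gaussianEntries ι).map fun w i => s * w i).withDensity
        fun y => ENNReal.ofReal (∏ i, responseDensity s (z i) (y i)) := by
  have hprob : ∀ c : ℝ, IsProbabilityMeasure ((gaussianReal 0 1).map (c + ·)) := fun c =>
    Measure.isProbabilityMeasure_map (by fun_prop)
  have hprob' : IsProbabilityMeasure ((gaussianReal 0 1).map (s * ·)) :=
    Measure.isProbabilityMeasure_map (by fun_prop)
  unfold gaussianEntries
  rw [Measure.pi_map_pi (f := fun i x => z i + x) (fun i => by fun_prop),
    Measure.pi_map_pi (f := fun i x => s * x) (fun i => by fun_prop),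
    ← pi_withDensity_ofReal (fun _ : ι => (gaussianReal 0 1).map (s * ·))
      (fun i => responseDensity s (z i)) (fun i => integrable_responseDensity hs (z i))
      fun i => responseDensity_nonneg hs (z i)]
  congr 1
  ext1 i
  rw [← gaussianReal_eq_withDensity hs, gaussianReal_map_const_add, zero_add]

end Density

/-! ### The null and planted laws, and their likelihood ratio -/

section Laws

open scoped ENNReal

variable {n p : ℕ}

/-- Standard Gaussian data with the responses multiplied by `s`. -/
def scaleResponse (s : ℝ) (x : DataIndex n p → ℝ) : DataIndex n p → ℝ :=
  Sum.elim (fun q => x (Sum.inl q)) fun i => s * x (Sum.inr i)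

/-- Data with the signal `β` planted in the responses. -/
noncomputable def plantSignal (σ : ℝ) (β : Fin p → ℝ) (x : DataIndex n p → ℝ) :
    DataIndex n p → ℝ :=
  Sum.elim (fun q => x (Sum.inl q))
    fun i => σ⁻¹ * (∑ j, x (Sum.inl (i, j)) * β j) + x (Sum.inr i)

theorem measurable_sumElim {α ι ι' : Type} [MeasurableSpace α] {f : α → ι → ℝ} {g : α → ι' → ℝ}
    (hf : Measurable f) (hg : Measurable g) : Measurable fun a => Sum.elim (f a) (g a) := by
  refine measurable_pi_iff.2 fun k => ?_
  rcases k with k | k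
  · exact (measurable_pi_apply k).comp hf
  · exact (measurable_pi_apply k).comp hg

theorem measurable_scaleResponse (s : ℝ) :
    Measurable (scaleResponse s : (DataIndex n p → ℝ) → DataIndex n p → ℝ) :=
  measurable_sumElim (by fun_prop) (by fun_prop)

theorem measurable_plantSignal (σ : ℝ) :
    Measurable fun q : (Fin p → ℝ) × (DataIndex n p → ℝ) => plantSignal σ q.1 q.2 :=
  measurable_sumElim (by fun_prop) (by fun_prop)

theorem measurable_plantSignal_right (σ : ℝ) (β : Fin p → ℝ) :
    Measurable (plantSignal σ β : (DataIndex n p → ℝ) → DataIndex n p → ℝ) :=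
  measurable_sumElim (by fun_prop) (by fun_prop)

theorem gaussianEntries_sum (ι ι' : Type) [Fintype ι] [Fintype ι'] :
    gaussianEntries (ι ⊕ ι') =
      ((gaussianEntries ι).prod (gaussianEntries ι')).map fun q => Sum.elim q.1 q.2 := by
  have h := (measurePreserving_sumPiEquivProdPi_symm
    (fun _ : ι ⊕ ι' => gaussianReal 0 1)).map_eq
  unfold gaussianEntries
  rw [← h]
  rfl

theorem lintegral_gaussianEntries_sum {ι ι' : Type} [Fintype ι] [Fintype ι']
    {F : (ι ⊕ ι' → ℝ) → ℝ≥0∞} (hF : Measurable F) :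
    ∫⁻ x, F x ∂(gaussianEntries (ι ⊕ ι')) =
      ∫⁻ x, ∫⁻ w, F (Sum.elim x w) ∂(gaussianEntries ι') ∂(gaussianEntries ι) := by
  have hm : Measurable fun q : (ι → ℝ) × (ι' → ℝ) => Sum.elim q.1 q.2 :=
    measurable_sumElim (by fun_prop) (by fun_prop)
  rw [gaussianEntries_sum, lintegral_map hF hm,
    lintegral_prod _ (hF.fun_comp hm).aemeasurable]

theorem mslrdNull_eq_map (r σ : ℝ) :
    mslrdNull n p r σ = (gaussianEntries (DataIndex n p)).map
      (scaleResponse √(r ^ 2 / σ ^ 2 + 1)) := by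
  rw [mslrdNull, gaussianEntries_sum, Measure.map_map (measurable_scaleResponse _)
    (measurable_sumElim (by fun_prop) (by fun_prop))]
  rfl

/-- With equal signals the weights z and 1 - z add up to 1, so the labels drop out and integrate to
1. -/
theorem slrdPlanted_eq_map (σ : ℝ) (φ : unitInterval) (P : Measure (Fin p → ℝ))
    [IsProbabilityMeasure P] :
    slrdPlanted n p σ φ P = (P.prod (gaussianEntries (DataIndex n p))).map
      fun q => plantSignal σ q.1 q.2 := by
  have hdiag : Measurable fun β : Fin p → ℝ => (β, β) := by fun_prop
  have := Measure.isProbabilityMeasure_map (μ := P) hdiag.aemeasurable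
  let Φ : (((Fin p → ℝ) × (Fin p → ℝ)) × (Fin n × Fin p → ℝ)) × ((Fin n → ℝ) × (Fin n → ℝ)) →
      DataIndex n p → ℝ := fun q => Sum.elim q.1.2 fun i =>
    σ⁻¹ * (∑ j, q.1.2 (i, j) * q.1.1.1 j) * q.2.1 i
      + σ⁻¹ * (∑ j, q.1.2 (i, j) * q.1.1.2 j) * (1 - q.2.1 i) + q.2.2 i
  have hΦ : Measurable Φ := measurable_sumElim (by fun_prop) (by fun_prop)
  refine Measure.ext_of_lintegral _ fun F hF => ?_
  have h1 := (hF.fun_comp hΦ).lintegral_prod_right' (ν := (Measure.pi fun _ : Fin n =>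
    bernoulliMeasure (1 : ℝ) 0 φ).prod (gaussianEntries (Fin n)))
  have h2 := h1.lintegral_prod_right' (ν := gaussianEntries (Fin n × Fin p))
  change ∫⁻ x, F x ∂(Measure.map Φ _) = _
  rw [lintegral_map hF hΦ, lintegral_map hF (measurable_plantSignal σ),
    lintegral_prod _ (hF.fun_comp hΦ).aemeasurable,
    lintegral_prod _ (hF.fun_comp (measurable_plantSignal σ)).aemeasurable,
    lintegral_prod _ h1.aemeasurable, lintegral_map h2 hdiag]
  refine lintegral_congr fun β => ?_
  rw [lintegral_gaussianEntries_sum]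
  swap
  · exact hF.fun_comp (measurable_plantSignal_right σ β)
  refine lintegral_congr fun x => ?_
  rw [lintegral_prod _ (hF.fun_comp (hΦ.fun_comp
    (by fun_prop : Measurable fun b => (((β, β), x), b)))).aemeasurable]
  have : ∀ z : Fin n → ℝ, ∫⁻ w, F (Φ (((β, β), x), (z, w))) ∂(gaussianEntries (Fin n)) =
      ∫⁻ w, F (plantSignal σ β (Sum.elim x w)) ∂(gaussianEntries (Fin n)) := by
    intro z
    refine lintegral_congr fun w => ?_
    congr 1
    ext k
    rcases k with k | k
    · rfl
    · simp only [plantSignal, Φ, Sum.elim_inr, Sum.elim_inl]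
      ring
  simp [this]

/-- The likelihood ratio of the data for a known signal. -/
noncomputable def signalDensity (s σ : ℝ) (β : Fin p → ℝ) (x : DataIndex n p → ℝ) : ℝ :=
  ∏ i, responseDensity s (σ⁻¹ * ∑ j, x (Sum.inl (i, j)) * β j) (x (Sum.inr i))

theorem measurable_signalDensity (s σ : ℝ) :
    Measurable fun q : (Fin p → ℝ) × (DataIndex n p → ℝ) => signalDensity s σ q.1 q.2 := by
  unfold signalDensity responseDensity
  fun_prop

/-- For a fixed design the signal only shifts the mean of the responses, so the one-dimensional
densities multiply. -/
theorem lintegral_plantSignal {s : ℝ} (hs : 0 < s) (σ : ℝ) (β : Fin p → ℝ)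
    {F : (DataIndex n p → ℝ) → ℝ≥0∞} (hF : Measurable F) :
    ∫⁻ x, F (plantSignal σ β x) ∂(gaussianEntries (DataIndex n p)) =
      ∫⁻ x, ENNReal.ofReal (signalDensity s σ β x) * F x
        ∂((gaussianEntries (DataIndex n p)).map (scaleResponse s)) := by
  have hd : Measurable fun x : DataIndex n p → ℝ => ENNReal.ofReal (signalDensity s σ β x) :=
    ((measurable_signalDensity s σ).comp (by fun_prop : Measurable fun x => (β, x))).ennreal_ofReal
  have hdF : Measurable fun x => ENNReal.ofReal (signalDensity s σ β x) * F x := hd.mul hF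
  rw [lintegral_map hdF (measurable_scaleResponse s), lintegral_gaussianEntries_sum
    (hF.fun_comp (measurable_plantSignal_right σ β)),
    lintegral_gaussianEntries_sum (hdF.fun_comp (measurable_scaleResponse s))]
  refine lintegral_congr fun x => ?_
  have hx : Measurable fun y : Fin n → ℝ => (Sum.elim x y : DataIndex n p → ℝ) :=
    measurable_sumElim (by fun_prop) (by fun_prop)
  set z : Fin n → ℝ := fun i => σ⁻¹ * ∑ j, x (i, j) * β j with hz
  have h1 : ∫⁻ y, F (Sum.elim x y) ∂((gaussianEntries (Fin n)).map fun w i => z i + w i) =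
      ∫⁻ w, F (plantSignal σ β (Sum.elim x w)) ∂(gaussianEntries (Fin n)) := by
    rw [lintegral_map (hF.fun_comp hx) (by fun_prop)]
    rfl
  rw [← h1, map_add_gaussianEntries hs, lintegral_withDensity_eq_lintegral_mul _ _ (hF.fun_comp hx),
    lintegral_map _ (by fun_prop)]
  · rfl
  · exact Measurable.mul (by unfold responseDensity; fun_prop) (hF.fun_comp hx)
  · unfold responseDensity; fun_prop

theorem slrdPlanted_eq_withDensity {r σ : ℝ} (φ : unitInterval) (P : Measure (Fin p → ℝ))
    [IsProbabilityMeasure P] :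
    slrdPlanted n p σ φ P = (mslrdNull n p r σ).withDensity
      fun x => ∫⁻ β, ENNReal.ofReal (signalDensity √(r ^ 2 / σ ^ 2 + 1) σ β x) ∂P := by
  have hs : 0 < √(r ^ 2 / σ ^ 2 + 1) := by positivity
  set s := √(r ^ 2 / σ ^ 2 + 1)
  have hm := (measurable_signalDensity (n := n) (p := p) s σ).ennreal_ofReal
  have hprob : IsProbabilityMeasure ((gaussianEntries (DataIndex n p)).map (scaleResponse s)) :=
    Measure.isProbabilityMeasure_map (measurable_scaleResponse s).aemeasurable
  refine Measure.ext_of_lintegral _ fun F hF => ?_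
  rw [slrdPlanted_eq_map, lintegral_map hF (measurable_plantSignal σ),
    lintegral_prod _ (hF.fun_comp (measurable_plantSignal σ)).aemeasurable, mslrdNull_eq_map,
    lintegral_withDensity_eq_lintegral_mul _ hm.lintegral_prod_left' hF]
  simp only [lintegral_plantSignal hs σ _ hF, Pi.mul_apply]
  rw [lintegral_lintegral_swap (hm.mul (hF.fun_comp measurable_snd)).aemeasurable]
  refine lintegral_congr fun x => ?_
  rw [lintegral_mul_const _ (hm.fun_comp (by fun_prop : Measurable fun β : Fin p → ℝ => (β, x)))]

end Laws

/-! ### Square integrability of the likelihood ratio -/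

section SquareIntegrable

open scoped ENNReal

theorem integrable_exp_mul_sq_gaussianReal {c : ℝ} (hc : c < 1 / 2) :
    Integrable (fun x : ℝ => Real.exp (c * x ^ 2)) (gaussianReal 0 1) := by
  rw [gaussianReal_of_var_ne_zero _ one_ne_zero, gaussianPDF_def,
    integrable_withDensity_iff_integrable_smul₀' (by fun_prop) (by simp)]
  refine ((integrable_exp_neg_mul_sq (b := 1 / 2 - c) (by linarith)).const_mul
    (√(2 * Real.pi))⁻¹).congr (Eventually.of_forall fun x => ?_)
  simp only [ENNReal.toReal_ofReal (gaussianPDFReal_nonneg 0 1 x), smul_eq_mul]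
  simp only [gaussianPDFReal_def, NNReal.coe_one, mul_one, sub_zero]
  rw [mul_assoc, ← Real.exp_add]
  ring_nf

/-- Young's inequality splits y z into squares, so that the bound depends on the signal only through
its norm. In the application Z is the squared norm of a row of the design. -/
theorem responseDensity_le {s z y Z : ℝ} (hs : 1 ≤ s ^ 2) (hs0 : 0 < s)
    (hz : z ^ 2 ≤ (s ^ 2 - 1) * Z) :
    responseDensity s z y ≤ s * Real.exp ((1 - s ^ 2 / (2 * s ^ 2 - 1 / 2)) / (2 * s ^ 2) * y ^ 2 +
      (s ^ 2 - 1) / (2 * s ^ 2 - 3 / 2) / 2 * Z) := by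
  unfold responseDensity
  refine mul_le_mul_of_nonneg_left (Real.exp_le_exp.2 ?_) hs0.le
  have h1 : 0 < 2 * s ^ 2 - 1 / 2 := by linarith
  have h2 : 0 < 2 * s ^ 2 - 3 / 2 := by linarith
  -- The Young weight is u = 1 - 1/(2s² - 1/2). It lies between 1 - 1/(2s² - 1) and 1 - 1/(2s²),
  -- exactly the range in which the squared bound is integrable in both the design and the response
  -- variables.
  set u := (2 * s ^ 2 - 3 / 2) / (2 * s ^ 2 - 1 / 2) with hu
  have hu0 : 0 < u := by positivity
  have hyz : y * z ≤ u * y ^ 2 / 2 + u⁻¹ * z ^ 2 / 2 := by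
    have h3 : 0 ≤ u * (y - u⁻¹ * z) ^ 2 := by positivity
    have h4 : u * (y - u⁻¹ * z) ^ 2 = u * y ^ 2 - 2 * (y * z) + u⁻¹ * z ^ 2 := by
      field_simp
      ring
    linarith
  have hz2 : (u⁻¹ - 1) / 2 * z ^ 2 ≤ (s ^ 2 - 1) / (2 * s ^ 2 - 3 / 2) / 2 * Z := by
    have h5 : u⁻¹ - 1 = 1 / (2 * s ^ 2 - 3 / 2) := by
      rw [hu, inv_div, div_sub_one h2.ne']
      congr 1
      ring
    have h6 : (s ^ 2 - 1) / (2 * s ^ 2 - 3 / 2) / 2 * Z =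
        1 / (2 * s ^ 2 - 3 / 2) / 2 * ((s ^ 2 - 1) * Z) := by ring
    rw [h5, h6]
    exact mul_le_mul_of_nonneg_left hz (by positivity)
  have hc : (1 - s ^ 2 / (2 * s ^ 2 - 1 / 2)) / (2 * s ^ 2) = -1 / 2 + 1 / (2 * s ^ 2) + u / 2 := by
    have hu' : u = 1 - 1 / (2 * s ^ 2 - 1 / 2) := by
      rw [hu, div_eq_iff h1.ne', sub_mul, one_div_mul_cancel h1.ne']
      ring
    rw [hu']
    have hd := h1.ne'
    generalize 2 * s ^ 2 - 1 / 2 = d at hd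
    field_simp
    ring
  have h7 : -(y - z) ^ 2 / 2 + y ^ 2 / (2 * s ^ 2) =
      (-1 / 2 + 1 / (2 * s ^ 2)) * y ^ 2 + y * z - z ^ 2 / 2 := by ring
  rw [h7, hc]
  linarith

variable {n p : ℕ}

/-- A function which dominates the likelihood ratios of all signals of a given norm. -/
noncomputable def densityBound (s : ℝ) (x : DataIndex n p → ℝ) : ℝ :=
  ∏ i, (s * Real.exp ((1 - s ^ 2 / (2 * s ^ 2 - 1 / 2)) / (2 * s ^ 2) * x (Sum.inr i) ^ 2 +
      (s ^ 2 - 1) / (2 * s ^ 2 - 3 / 2) / 2 * ∑ j, x (Sum.inl (i, j)) ^ 2))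

theorem signalDensity_le {s σ : ℝ} {β : Fin p → ℝ} (hs : 0 < s)
    (hβ : s ^ 2 = (∑ j, β j ^ 2) / σ ^ 2 + 1) (x : DataIndex n p → ℝ) :
    signalDensity s σ β x ≤ densityBound s x := by
  refine Finset.prod_le_prod (fun i _ => responseDensity_nonneg hs _ _) fun i _ => ?_
  refine responseDensity_le ?_ hs ?_
  · rw [hβ]
    have : 0 ≤ (∑ j, β j ^ 2) / σ ^ 2 := by positivity
    linarith
  · have h := Finset.sum_mul_sq_le_sq_mul_sq Finset.univ (fun j => x (Sum.inl (i, j))) β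
    have h2 : s ^ 2 - 1 = (σ⁻¹) ^ 2 * ∑ j, β j ^ 2 := by
      rw [hβ, inv_pow]; ring
    rw [h2, mul_pow, mul_assoc]
    refine mul_le_mul_of_nonneg_left (h.trans_eq (mul_comm _ _)) (by positivity)

theorem measurable_densityBound (s : ℝ) :
    Measurable (densityBound s : (DataIndex n p → ℝ) → ℝ) := by
  unfold densityBound
  fun_prop

/-- After squaring and rescaling, each coordinate carries a factor exp(c x²) with c < 1/2, which is
integrable for N(0, 1). -/
theorem memLp_densityBound {s : ℝ} (hs0 : 0 < s) (hs : 1 ≤ s ^ 2) :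
    MemLp (densityBound s) 2 ((gaussianEntries (DataIndex n p)).map (scaleResponse s)) := by
  rw [memLp_map_measure_iff (measurable_densityBound s).aestronglyMeasurable
    (measurable_scaleResponse s).aemeasurable, memLp_two_iff_integrable_sq
    ((measurable_densityBound s).comp (measurable_scaleResponse s)).aestronglyMeasurable]
  have h1 : 0 < 2 * s ^ 2 - 1 / 2 := by linarith
  have h2 : 0 < 2 * s ^ 2 - 3 / 2 := by linarith
  have hint := Integrable.fintype_prod (μ := fun _ : DataIndex n p => gaussianReal 0 1)
    (f := fun k (x : ℝ) => Real.exp (Sum.elim (fun _ => (s ^ 2 - 1) / (2 * s ^ 2 - 3 / 2))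
      (fun _ => 1 - s ^ 2 / (2 * s ^ 2 - 1 / 2)) k * x ^ 2)) fun k => by
      apply integrable_exp_mul_sq_gaussianReal
      rcases k with k | k
      · simp only [Sum.elim_inl]
        rw [div_lt_iff₀ h2]
        linarith
      · simp only [Sum.elim_inr]
        have : 1 / 2 < s ^ 2 / (2 * s ^ 2 - 1 / 2) := by
          rw [lt_div_iff₀ h1]
          linarith
        linarith
  refine (hint.const_mul ((s ^ 2) ^ n)).congr (Eventually.of_forall fun x => ?_)
  simp only [Function.comp_apply, densityBound, scaleResponse, Sum.elim_inl, Sum.elim_inr,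
    Fintype.sum_sum_type, Fintype.sum_prod_type, ← Real.exp_sum, Finset.prod_mul_distrib,
    Finset.prod_const, Finset.card_univ, Fintype.card_fin]
  rw [mul_pow, ← pow_mul, ← pow_mul, mul_comm 2 n, ← Real.exp_nat_mul]
  congr 2
  simp only [Finset.mul_sum, Finset.sum_add_distrib, mul_add]
  rw [add_comm]
  congr 1
  · refine Finset.sum_congr rfl fun i _ => ?_
    push_cast
    field_simp
  · refine Finset.sum_congr rfl fun i _ => Finset.sum_congr rfl fun j _ => ?_
    push_cast
    ring

/-- The likelihood ratio is the prior average of the densities for known signals. As the norm is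
almost surely r, all of them lie below the same square-integrable function. -/
theorem absolutelyContinuous_and_memLp_likelihoodRatio {r σ : ℝ} (φ : unitInterval)
    (P : Measure (Fin p → ℝ)) [IsProbabilityMeasure P]
    (hP : ∀ᵐ β ∂P, ∑ j, β j ^ 2 = r ^ 2) :
    slrdPlanted n p σ φ P ≪ mslrdNull n p r σ ∧
      MemLp (likelihoodRatio (slrdPlanted n p σ φ P) (mslrdNull n p r σ)) 2
        (mslrdNull n p r σ) := by
  set s := √(r ^ 2 / σ ^ 2 + 1) with hs
  have hs0 : 0 < s := by positivity
  have hs2 : s ^ 2 = r ^ 2 / σ ^ 2 + 1 := Real.sq_sqrt (by positivity)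
  have hs1 : 1 ≤ s ^ 2 := by
    have : 0 ≤ r ^ 2 / σ ^ 2 := by positivity
    linarith
  have hprob : IsProbabilityMeasure (mslrdNull n p r σ) := by
    rw [mslrdNull_eq_map]
    exact Measure.isProbabilityMeasure_map (measurable_scaleResponse _).aemeasurable
  have hw := slrdPlanted_eq_withDensity (n := n) (r := r) (σ := σ) φ P
  have hm : Measurable fun x : DataIndex n p → ℝ =>
      ∫⁻ β, ENNReal.ofReal (signalDensity s σ β x) ∂P :=
    (measurable_signalDensity s σ).ennreal_ofReal.lintegral_prod_left'
  refine ⟨by rw [hw]; exact withDensity_absolutelyContinuous _ _, ?_⟩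
  have hrn := Measure.rnDeriv_withDensity (mslrdNull n p r σ) hm
  rw [← hw] at hrn
  have hG := memLp_densityBound (n := n) (p := p) hs0 hs1
  rw [← mslrdNull_eq_map] at hG
  refine hG.mono' (Measure.measurable_rnDeriv _ _).ennreal_toReal.aestronglyMeasurable ?_
  filter_upwards [hrn] with x hx
  have hle : ∫⁻ β, ENNReal.ofReal (signalDensity s σ β x) ∂P ≤
      ENNReal.ofReal (densityBound s x) := by
    calc ∫⁻ β, ENNReal.ofReal (signalDensity s σ β x) ∂P
        ≤ ∫⁻ _, ENNReal.ofReal (densityBound s x) ∂P := by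
          refine lintegral_mono_ae ?_
          filter_upwards [hP] with β hβ
          exact ENNReal.ofReal_le_ofReal (signalDensity_le hs0 (by rw [hs2, hβ]) x)
      _ = _ := by simp
  have h0 : 0 ≤ densityBound s x := by unfold densityBound; positivity
  rw [likelihoodRatio, hx, Real.norm_of_nonneg ENNReal.toReal_nonneg]
  exact ENNReal.toReal_le_of_le_ofReal h0 hle

end SquareIntegrable

/-! ### From the projected likelihood ratio to the overlap of two signals -/

section Projection

open MvPolynomial

/-- If `f` has the same inner product with itself as with a mixture of functions `G a`, then its
squared norm is at most that of the mixture. -/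
theorem integral_sq_le_of_eq_integral_mixture {A B : Type} [MeasurableSpace A] [MeasurableSpace B]
    {μ : Measure A} {γ : Measure B} [IsProbabilityMeasure μ] [IsProbabilityMeasure γ]
    {G : A × B → ℝ} (hG : MemLp G 2 (μ.prod γ)) {f : B → ℝ} (hf : MemLp f 2 γ)
    (h : ∫ b, f b ^ 2 ∂γ = ∫ a, ∫ b, G (a, b) * f b ∂γ ∂μ) :
    ∫ b, f b ^ 2 ∂γ ≤ ∫ q, ∫ b, G (q.1, b) * G (q.2, b) ∂γ ∂(μ.prod μ) := by
  have hfst : MeasurePreserving (fun q : (A × A) × B => (q.1.1, q.2)) ((μ.prod μ).prod γ)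
      (μ.prod γ) := measurePreserving_fst.prod (MeasurePreserving.id γ)
  have hsnd : MeasurePreserving (fun q : (A × A) × B => (q.1.2, q.2)) ((μ.prod μ).prod γ)
      (μ.prod γ) := measurePreserving_snd.prod (MeasurePreserving.id γ)
  have hGG : Integrable (fun q : (A × A) × B => G (q.1.1, q.2) * G (q.1.2, q.2))
      ((μ.prod μ).prod γ) :=
    (hG.comp_measurePreserving hfst).integrable_mul (hG.comp_measurePreserving hsnd)
  have hGf : Integrable (fun q : A × B => G q * f q.2) (μ.prod γ) :=
    hG.integrable_mul (hf.comp_measurePreserving measurePreserving_snd)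
  set m : B → ℝ := fun b => ∫ a, G (a, b) ∂μ with hm
  have hmm : ∀ b, m b ^ 2 = ∫ q, G (q.1, b) * G (q.2, b) ∂(μ.prod μ) := by
    intro b
    rw [integral_prod_mul (fun a => G (a, b)) (fun a => G (a, b)), sq]
  have hm2 : Integrable (fun b => m b ^ 2) γ := by
    simp only [hmm]
    exact hGG.integral_prod_right
  have hmf : Integrable (fun b => m b * f b) γ := by
    have := hGf.integral_prod_right
    simpa only [integral_mul_const] using this
  have h1 : ∫ b, m b * f b ∂γ = ∫ b, f b ^ 2 ∂γ := by
    rw [h, integral_integral_swap hGf]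
    simp only [integral_mul_const, hm]
  have h2 : ∫ b, m b ^ 2 ∂γ = ∫ q, ∫ b, G (q.1, b) * G (q.2, b) ∂γ ∂(μ.prod μ) := by
    simp only [hmm]
    rw [integral_integral_swap (f := fun b (q : A × A) => G (q.1, b) * G (q.2, b)) hGG.swap]
  rw [← h2]
  -- Cauchy-Schwarz in expanded form: since ⟨m, f⟩ = ‖f‖², the left side equals ‖m‖² - ‖f‖².
  have h3 : 0 ≤ ∫ b, (m b - f b) ^ 2 ∂γ := integral_nonneg fun b => sq_nonneg _
  have h4 : ∫ b, (m b - f b) ^ 2 ∂γ =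
      ∫ b, m b ^ 2 ∂γ - 2 * ∫ b, m b * f b ∂γ + ∫ b, f b ^ 2 ∂γ := by
    have hsub : Integrable (fun b => m b ^ 2 - 2 * (m b * f b)) γ := hm2.sub (hmf.const_mul 2)
    rw [← integral_const_mul, ← integral_sub hm2 (hmf.const_mul 2),
      ← integral_add hsub hf.integrable_sq]
    exact integral_congr_ae (Eventually.of_forall fun b => by ring)
  rw [h4, h1] at h3
  linarith

theorem totalDegree_aeval_le {ι κ : Type} {g : ι → MvPolynomial κ ℝ}
    (hg : ∀ i, (g i).totalDegree ≤ 1) (f : MvPolynomial ι ℝ) :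
    (aeval g f).totalDegree ≤ f.totalDegree := by
  rw [aeval_def, eval₂_eq]
  refine totalDegree_finsetSum_le fun s hs => ?_
  refine (totalDegree_mul _ _).trans ?_
  rw [algebraMap_eq, totalDegree_C, zero_add]
  refine (totalDegree_finsetProd _ _).trans ((Finset.sum_le_sum fun i _ => ?_).trans
    (le_totalDegree hs))
  exact (totalDegree_pow _ _).trans ((Nat.mul_le_mul_left _ (hg i)).trans_eq (mul_one _))

variable {n p : ℕ}

/-- The change of variables of polynomials that normalizes the responses. -/
noncomputable def rescaleResponse (s : ℝ) :
    MvPolynomial (DataIndex n p) ℝ →ₐ[ℝ] MvPolynomial (DataIndex n p) ℝ :=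
  aeval (Sum.elim (fun q => X (Sum.inl q)) fun i => C s * X (Sum.inr i))

theorem eval_rescaleResponse (s : ℝ) (f : MvPolynomial (DataIndex n p) ℝ)
    (x : DataIndex n p → ℝ) : eval x (rescaleResponse s f) = eval (scaleResponse s x) f := by
  induction f using MvPolynomial.induction_on with
  | C c => simp [rescaleResponse]
  | add f g hf hg => simp only [map_add, hf, hg]
  | mul_X f k hf =>
    rw [map_mul, map_mul, map_mul, hf, eval_X]
    congr 1
    rcases k with k | k <;> simp [rescaleResponse, scaleResponse]

theorem totalDegree_rescaleResponse_le (s : ℝ) (f : MvPolynomial (DataIndex n p) ℝ) :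
    (rescaleResponse s f).totalDegree ≤ f.totalDegree := by
  refine totalDegree_aeval_le (fun k => ?_) f
  rcases k with k | k
  · simp
  · rw [Sum.elim_inr]
    refine (totalDegree_mul _ _).trans ?_
    simp

theorem eval_linForm {κ : Type} [Fintype κ] (a x : κ → ℝ) : eval x (linForm a) = a ⬝ᵥ x := by
  simp [linForm, dotProduct]

/-- Dividing Xβ/σ + w by s gives direction β/(σs) and noise level 1/s; the rescaling of f undoes
this division. -/
theorem eval_aeval_plantedRow {s : ℝ} (hs : s ≠ 0) (σ : ℝ) (β : Fin p → ℝ)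
    (f : MvPolynomial (DataIndex n p) ℝ) (x : DataIndex n p → ℝ) :
    eval x (aeval (fun k => linForm (plantedRow s⁻¹ ((σ * s)⁻¹ • β) k)) (rescaleResponse s f)) =
      eval (plantSignal σ β x) f := by
  induction f using MvPolynomial.induction_on with
  | C c => simp [rescaleResponse]
  | add f g hf hg => simp only [map_add, hf, hg]
  | mul_X f k hf =>
    rw [map_mul, map_mul, map_mul, map_mul, hf, eval_X]
    congr 1
    rcases k with ⟨i, j⟩ | i
    · simp only [rescaleResponse, aeval_X, Sum.elim_inl, eval_linForm, plantedRow, plantSignal]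
      simp [dotProduct, designVec, Fintype.sum_prod_type, Pi.single_apply]
    · simp only [rescaleResponse, aeval_X, Sum.elim_inr, map_mul, algHom_C, algebraMap_eq, eval_C,
        eval_linForm, plantedRow, plantSignal]
      simp only [dotProduct, designVec, responseVec, Fintype.sum_sum_type, Fintype.sum_prod_type,
        Pi.add_apply, Pi.smul_apply, Sum.elim_inl, Sum.elim_inr, smul_eq_mul, Pi.zero_apply,
        mul_zero, add_zero, zero_add, Pi.single_apply, ite_mul, zero_mul, mul_ite, mul_one]
      rw [mul_add, Finset.sum_comm]
      simp only [Finset.sum_ite_eq', Finset.mem_univ, if_true]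
      rw [mul_inv_cancel_left₀ hs, Finset.mul_sum, Finset.mul_sum]
      congr 1
      refine Finset.sum_congr rfl fun j _ => ?_
      rw [mul_inv]
      field_simp

theorem designVec_eq_sum (a : Fin p → ℝ) (i : Fin n) :
    designVec a i = ∑ j, a j • designVec (Pi.single j 1) i := by
  ext k
  rcases k with k | k
  · simp [designVec, Finset.sum_apply, Pi.single_apply]
  · simp [designVec, Finset.sum_apply]

theorem dirAdjoint_sum_smul {κ : Type} [Fintype κ] (c : Fin p → ℝ) (v : Fin p → κ → ℝ)
    (g : MvPolynomial κ ℝ) :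
    dirAdjoint (∑ j, c j • v j) g = ∑ j, c j • dirAdjoint (v j) g := by
  have h2 : linForm (∑ j, c j • v j) = ∑ j, c j • linForm (v j) := by
    simp only [linForm, Finset.smul_sum, Finset.sum_apply, Pi.smul_apply, map_sum, smul_eq_mul,
      map_mul, Finset.sum_mul, smul_eq_C_mul, mul_assoc]
    rw [Finset.sum_comm]
  have h3 : dirDeriv (∑ j, c j • v j) g = ∑ j, c j • dirDeriv (v j) g := by
    simp only [dirDeriv_eq_sum, Finset.smul_sum, Finset.sum_apply, Pi.smul_apply, smul_eq_mul,
      Finset.sum_smul, smul_smul]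
    rw [Finset.sum_comm]
  simp only [dirAdjoint_apply, smul_sub, Finset.sum_sub_distrib]
  rw [h2, h3, Finset.sum_mul]
  simp only [smul_mul_assoc]

/-- The adjoint is linear in a, so the value is a polynomial in the entries of a. A general
functional ℓ is needed because the induction step composes it with the adjoints along basis vectors.
-/
theorem measurable_couplingAdjoint_pow (m : ℕ) (ℓ : MvPolynomial (DataIndex n p) ℝ →ₗ[ℝ] ℝ) :
    Measurable fun a : Fin p → ℝ => ℓ ((couplingAdjoint a ^ m) 1) := by
  induction m generalizing ℓ with
  | zero => simp
  | succ m ih =>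
    have hexp : ∀ a : Fin p → ℝ, ℓ ((couplingAdjoint a ^ (m + 1)) 1) =
        ∑ i, ∑ j, a j * ℓ (dirAdjoint (responseVec i)
          (dirAdjoint (designVec (Pi.single j 1) i) ((couplingAdjoint a ^ m) 1))) := by
      intro a
      rw [pow_succ', Module.End.mul_apply, couplingAdjoint_apply, map_sum]
      refine Finset.sum_congr rfl fun i _ => ?_
      rw [designVec_eq_sum a i, dirAdjoint_sum_smul, map_sum, map_sum]
      refine Finset.sum_congr rfl fun j _ => ?_
      rw [map_smul, map_smul, smul_eq_mul]
    simp only [hexp]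
    refine Finset.measurable_sum _ fun i _ => Finset.measurable_sum _ fun j _ => ?_
    exact (measurable_pi_apply j).mul (ih (ℓ ∘ₗ dirAdjoint (responseVec i) ∘ₗ
      dirAdjoint (designVec (Pi.single j 1) i)))

theorem eval_plantedKernel (M : ℕ) (a : Fin p → ℝ) (x : DataIndex n p → ℝ) :
    eval x (plantedKernel n M a) = ∑ m ∈ Finset.range (M + 1),
      (m.factorial : ℝ)⁻¹ * (aeval x).toLinearMap ((couplingAdjoint a ^ m) 1) := by
  rw [plantedKernel, map_sum]
  refine Finset.sum_congr rfl fun m _ => ?_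
  rw [smul_eval, AlgHom.toLinearMap_apply, ← coe_aeval_eq_eval]
  rfl

theorem measurable_of_uncurry_swap {A B : Type} [MeasurableSpace A] [MeasurableSpace B]
    (u : B → A → ℝ) (h : Measurable (Function.uncurry u)) :
    Measurable fun q : A × B => u q.2 q.1 :=
  h.comp measurable_swap

/-- A Carathéodory argument: continuous in the data for a fixed signal, measurable in the signal for
fixed data. -/
theorem measurable_plantedKernel (M : ℕ) :
    Measurable fun q : (Fin p → ℝ) × (DataIndex n p → ℝ) => eval q.2 (plantedKernel n M q.1) := by
  have h : Measurable (Function.uncurry fun (x : DataIndex n p → ℝ) (a : Fin p → ℝ) =>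
      eval x (plantedKernel n M a)) := by
    refine measurable_uncurry_of_continuous_of_measurable
      (fun a => MvPolynomial.continuous_eval (plantedKernel n M a)) fun x => ?_
    simp only [eval_plantedKernel]
    exact Finset.measurable_sum _ fun m _ =>
      (measurable_couplingAdjoint_pow m (aeval x).toLinearMap).const_mul _
  exact measurable_of_uncurry_swap (fun x a => eval x (plantedKernel n M a)) h

/-- The L² norm of the kernel depends on a only through a ⬝ᵥ a, which is almost surely constant. -/
theorem memLp_plantedKernel (M : ℕ) {μ : Measure (Fin p → ℝ)} [IsProbabilityMeasure μ] {b : ℝ}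
    (hμ : ∀ᵐ a ∂μ, a ⬝ᵥ a = b) :
    MemLp (fun q : (Fin p → ℝ) × (DataIndex n p → ℝ) => eval q.2 (plantedKernel n M q.1)) 2
      (μ.prod (gaussianEntries (DataIndex n p))) := by
  have hm := measurable_plantedKernel (n := n) (p := p) M
  rw [memLp_two_iff_integrable_sq hm.aestronglyMeasurable,
    integrable_prod_iff (hm.pow_const 2).aestronglyMeasurable]
  constructor
  · exact Eventually.of_forall fun a =>
      (memLp_eval_gaussianEntries (plantedKernel n M a)).integrable_sq
  · refine (integrable_const (∑ m ∈ Finset.range (M + 1), negBinomCoeff n m * b ^ m)).congr ?_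
    filter_upwards [hμ] with a ha
    rw [← ha, ← isGaussianFunctional_gaussianExpectation.map_plantedKernel_mul,
      gaussianExpectation_apply]
    refine integral_congr_ae (Eventually.of_forall fun x => ?_)
    simp [sq]

/-- The projected likelihood ratio has the same inner product with itself as with the mixture of
kernels, so its norm is at most that of the mixture. Expanding the latter over two independent
signals gives the integral. -/
theorem lowDegChiSq_slrd_le {r σ : ℝ} (hσ : 0 < σ) (φ : unitInterval)
    (P : Measure (Fin p → ℝ)) [IsProbabilityMeasure P]
    (hP : ∀ᵐ β ∂P, ∑ j, β j ^ 2 = r ^ 2) (D : ℕ) :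
    lowDegChiSq (slrdPlanted n p σ φ P) (mslrdNull n p r σ) D ≤
      ((∫ q, ∑ m ∈ Finset.range (D / 2 + 1), negBinomCoeff n m *
        ((q.1 ⬝ᵥ q.2) / (r ^ 2 + σ ^ 2)) ^ m ∂(P.prod P) - 1 : ℝ) : EReal) := by
  set s := √(r ^ 2 / σ ^ 2 + 1) with hs
  have hs0 : 0 < s := by positivity
  have hs2 : s ^ 2 = r ^ 2 / σ ^ 2 + 1 := Real.sq_sqrt (by positivity)
  have hσs : (σ * s) ^ 2 = r ^ 2 + σ ^ 2 := by
    rw [mul_pow, hs2]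
    field_simp
  have hac := absolutelyContinuous_and_memLp_likelihoodRatio (n := n) (r := r) (σ := σ) φ P hP
  have hprob : IsProbabilityMeasure (mslrdNull n p r σ) := by
    rw [mslrdNull_eq_map]
    exact Measure.isProbabilityMeasure_map (measurable_scaleResponse _).aemeasurable
  have hprob' : IsProbabilityMeasure (slrdPlanted n p σ φ P) := by
    rw [slrdPlanted_eq_map]
    exact Measure.isProbabilityMeasure_map (measurable_plantSignal _).aemeasurable
  have hld : (slrdPlanted n p σ φ P).HaveLebesgueDecomposition (mslrdNull n p r σ) :=
    Measure.haveLebesgueDecomposition_of_sigmaFinite _ _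
  rw [lowDegChiSq, dif_pos hac, EReal.coe_le_coe_iff]
  refine sub_le_sub_right ?_ 1
  set Q := mslrdNull n p r σ with hQ
  set L := hac.2.toLp _ with hL
  set g := (lowDegSubspace Q D).starProjection L with hg
  obtain ⟨f, hfD, hgf⟩ : g ∈ lowDegSubspace Q D := by simp [hg]
  have hfm := measurable_eval_mvPolynomial f
  have hfQ : MemLp (fun x => eval x f) 2 Q := (Lp.memLp g).ae_eq hgf
  -- the squared norm is the planted expectation of the projection
  have h1 : ∫ x, g x ^ 2 ∂Q = ∫ x, eval x f ∂(slrdPlanted n p σ φ P) := by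
    -- The projection is self-adjoint and fixes g.
    have h2 : inner ℝ g g = inner ℝ L g := by
      conv_lhs => rw [hg, Submodule.inner_starProjection_left_eq_right]
      rw [← hg, Submodule.starProjection_eq_self_iff.2 (by simp [hg])]
    rw [L2.inner_def, L2.inner_def] at h2
    rw [← integral_rnDeriv_smul hac.1]
    calc ∫ x, g x ^ 2 ∂Q = ∫ x, inner ℝ (g x) (g x) ∂Q := by
          simp [sq]
      _ = ∫ x, inner ℝ (L x) (g x) ∂Q := h2
      _ = _ := by
        refine integral_congr_ae ?_
        filter_upwards [hgf, MemLp.coeFn_toLp hac.2] with x hx hx'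
        rw [hx, hx']
        simp [likelihoodRatio, mul_comm]
  have h2 : ∫ x, g x ^ 2 ∂Q = ∫ x, eval x (rescaleResponse s f) ^ 2
      ∂(gaussianEntries (DataIndex n p)) := by
    rw [integral_congr_ae (g := fun x => eval x f ^ 2) (hgf.mono fun x hx => by simp only [hx]), hQ, mslrdNull_eq_map,
      integral_map (measurable_scaleResponse _).aemeasurable
        (hfm.pow_const 2).aestronglyMeasurable]
    simp only [eval_rescaleResponse, hs]
  have hfP : Integrable (fun x => eval x f) (slrdPlanted n p σ φ P) := by
    rw [← integrable_rnDeriv_smul_iff hac.1]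
    exact hac.2.integrable_mul hfQ
  have hplant : Integrable (fun q : (Fin p → ℝ) × (DataIndex n p → ℝ) =>
      eval (plantSignal σ q.1 q.2) f) (P.prod (gaussianEntries (DataIndex n p))) := by
    rw [slrdPlanted_eq_map] at hfP
    exact hfP.comp_measurable (measurable_plantSignal σ)
  have hca : ∀ᵐ β ∂P, ((σ * s)⁻¹ • β) ⬝ᵥ ((σ * s)⁻¹ • β) = r ^ 2 / (r ^ 2 + σ ^ 2) := by
    filter_upwards [hP] with β hβ
    have : β ⬝ᵥ β = r ^ 2 := by rw [← hβ]; simp [dotProduct, sq]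
    rw [smul_dotProduct, dotProduct_smul, this, ← hσs]
    simp only [smul_eq_mul]
    field_simp
  have h3 : ∫ x, eval x f ∂(slrdPlanted n p σ φ P) = ∫ β, ∫ x,
      eval x (plantedKernel n (D / 2) ((σ * s)⁻¹ • β)) * eval x (rescaleResponse s f)
        ∂(gaussianEntries (DataIndex n p)) ∂P := by
    rw [slrdPlanted_eq_map, integral_map (measurable_plantSignal σ).aemeasurable
      hfm.aestronglyMeasurable, integral_prod _ hplant]
    refine integral_congr_ae ?_
    filter_upwards [hca] with β hβ
    have hc : ((σ * s)⁻¹ • β) ⬝ᵥ ((σ * s)⁻¹ • β) + s⁻¹ ^ 2 = 1 := by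
      rw [hβ, inv_pow, hs2]
      field_simp
    -- Truncation at the integer part of D / 2 suffices because D ≤ 2(D / 2) + 1.
    have h4 := isGaussianFunctional_gaussianExpectation.map_plantedKernel_mul_eq_map_aeval hc (D / 2)
      (rescaleResponse s f) ((totalDegree_rescaleResponse_le s f).trans (hfD.trans (by omega)))
    simp only [gaussianExpectation_apply, eval_aeval_plantedRow hs0.ne', map_mul] at h4
    exact h4.symm
  have hmeas : Measurable fun β : Fin p → ℝ => (σ * s)⁻¹ • β := by fun_prop
  set ν := P.map fun β : Fin p → ℝ => (σ * s)⁻¹ • β with hν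
  have : IsProbabilityMeasure ν := Measure.isProbabilityMeasure_map hmeas.aemeasurable
  have hG : MemLp (fun q : (Fin p → ℝ) × (DataIndex n p → ℝ) =>
      eval q.2 (plantedKernel n (D / 2) ((σ * s)⁻¹ • q.1))) 2
      (P.prod (gaussianEntries (DataIndex n p))) := by
    have h5 : MeasurePreserving (fun q : (Fin p → ℝ) × (DataIndex n p → ℝ) =>
        ((σ * s)⁻¹ • q.1, q.2)) (P.prod (gaussianEntries (DataIndex n p)))
        (ν.prod (gaussianEntries (DataIndex n p))) :=
      (MeasurePreserving.mk hmeas rfl).prod (MeasurePreserving.id _)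
    have h6 : ∀ᵐ a ∂ν, a ⬝ᵥ a = r ^ 2 / (r ^ 2 + σ ^ 2) := by
      have hms : MeasurableSet {a : Fin p → ℝ | a ⬝ᵥ a = r ^ 2 / (r ^ 2 + σ ^ 2)} :=
        measurableSet_eq_fun (by unfold dotProduct; fun_prop) measurable_const
      rw [hν, ae_map_iff hmeas.aemeasurable hms]
      exact hca
    exact (memLp_plantedKernel (n := n) (D / 2) h6).comp_measurePreserving h5
  rw [h2]
  refine (integral_sq_le_of_eq_integral_mixture hG (memLp_eval_gaussianEntries _)
    (h2.symm.trans (h1.trans h3))).trans_eq ?_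
  refine integral_congr_ae (Eventually.of_forall fun q => ?_)
  have h6 := isGaussianFunctional_gaussianExpectation.map_plantedKernel_mul (n := n) (D / 2)
    ((σ * s)⁻¹ • q.1) ((σ * s)⁻¹ • q.2)
  simp only [gaussianExpectation_apply, map_mul] at h6
  refine h6.trans ?_
  rw [← hσs, smul_dotProduct, dotProduct_smul]
  refine Finset.sum_congr rfl fun m _ => ?_
  congr 2
  simp only [smul_eq_mul]
  field_simp

end Projection

/-! ### The overlap of two random supports -/

section Overlap

/-- A uniform k-set contains j given points with probability ∏_{i<j} (k - i)/(p - i), and each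
factor is at most k/p. -/
theorem choose_sub_mul_pow_le {p k : ℕ} (hkp : k ≤ p) (j : ℕ) (hj : j ≤ k) :
    (p - j).choose (k - j) * p ^ j ≤ p.choose k * k ^ j := by
  induction j with
  | zero => simp
  | succ j ih =>
    have h1 := ih (by omega)
    have h2 : (p - j) * (p - (j + 1)).choose (k - (j + 1)) = (p - j).choose (k - j) * (k - j) := by
      have h3 := Nat.add_one_mul_choose_eq (p - (j + 1)) (k - (j + 1))
      rwa [show p - (j + 1) + 1 = p - j by omega, show k - (j + 1) + 1 = k - j by omega] at h3
    have h4 : (k - j) * p ≤ (p - j) * k := by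
      rw [Nat.sub_mul, Nat.sub_mul, mul_comm k p]
      exact Nat.sub_le_sub_left (Nat.mul_le_mul_left j hkp) _
    have h5 : 0 < p - j := by omega
    refine Nat.le_of_mul_le_mul_left ?_ h5
    calc (p - j) * ((p - (j + 1)).choose (k - (j + 1)) * p ^ (j + 1))
        = ((p - j) * (p - (j + 1)).choose (k - (j + 1))) * p ^ (j + 1) := by ring
      _ = ((p - j).choose (k - j) * p ^ j) * ((k - j) * p) := by rw [h2]; ring
      _ ≤ (p.choose k * k ^ j) * ((p - j) * k) := Nat.mul_le_mul h1 h4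
      _ = _ := by ring

theorem card_filter_superset_le {p : ℕ} (k : ℕ) (T : Finset (Fin p)) :
    ((Finset.powersetCard k (Finset.univ : Finset (Fin p))).filter (T ⊆ ·)).card ≤
      (p - T.card).choose (k - T.card) := by
  have h : (Finset.powersetCard (k - T.card) (Finset.univ \ T)).card =
      (p - T.card).choose (k - T.card) := by
    rw [Finset.card_powersetCard, Finset.card_sdiff_of_subset (Finset.subset_univ T)]
    simp
  rw [← h]
  refine Finset.card_le_card_of_injOn (· \ T) ?_ ?_
  · intro S hS
    obtain ⟨h1, h2⟩ := Finset.mem_filter.1 hS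
    rw [Finset.mem_powersetCard_univ] at h1
    refine Finset.mem_coe.2 (Finset.mem_powersetCard.2
      ⟨Finset.sdiff_subset_sdiff (Finset.subset_univ _) le_rfl, ?_⟩)
    rw [Finset.card_sdiff_of_subset h2, h1]
  · intro S hS S' hS' hSS
    have h1 := (Finset.mem_filter.1 hS).2
    have h2 := (Finset.mem_filter.1 hS').2
    rw [← Finset.sdiff_union_of_subset h1, ← Finset.sdiff_union_of_subset h2]
    exact congrArg (· ∪ T) hSS

/-- The generating function of the overlap of a `k`-element set with a uniform one. -/
theorem sum_pow_card_inter_le {p k : ℕ} (hkp : k ≤ p) {x : ℝ} (hx : 1 ≤ x) {S : Finset (Fin p)}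
    (hS : S.card = k) :
    ∑ S' ∈ Finset.powersetCard k (Finset.univ : Finset (Fin p)), x ^ (S ∩ S').card ≤
      p.choose k * Real.exp (x * k ^ 2 / p) := by
  rcases Nat.eq_zero_or_pos p with rfl | hp
  · obtain rfl : k = 0 := by omega
    obtain rfl : S = ∅ := Finset.card_eq_zero.1 hS
    simp
  have hp' : (0 : ℝ) < p := by exact_mod_cast hp
  have hy : 0 ≤ x - 1 := by linarith
  -- Expand x = (x - 1) + 1 over the subsets of the intersection. This leaves only containment
  -- probabilities, and the nonnegative weights allow termwise bounds.
  have h1 : ∀ S' : Finset (Fin p), x ^ (S ∩ S').card =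
      ∑ T ∈ S.powerset, if T ⊆ S' then (x - 1) ^ T.card else 0 := by
    intro S'
    have h2 := Finset.sum_pow_mul_eq_add_pow (x - 1) 1 (S ∩ S')
    rw [sub_add_cancel] at h2
    rw [← h2, ← Finset.sum_filter]
    refine Finset.sum_congr ?_ fun T _ => by simp
    ext T
    simp only [Finset.mem_powerset, Finset.mem_filter, Finset.subset_inter_iff]
  have h3 : ∀ T ∈ S.powerset, ((((Finset.powersetCard k (Finset.univ : Finset (Fin p))).filter
      (T ⊆ ·)).card : ℕ) : ℝ) ≤ p.choose k * (k / p : ℝ) ^ T.card := by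
    intro T hT
    have hTk : T.card ≤ k := hS ▸ Finset.card_le_card (Finset.mem_powerset.1 hT)
    have h4 : (((p - T.card).choose (k - T.card) * p ^ T.card : ℕ) : ℝ) ≤
        ((p.choose k * k ^ T.card : ℕ) : ℝ) := by
      exact_mod_cast choose_sub_mul_pow_le hkp T.card hTk
    push_cast at h4
    rw [div_pow, ← mul_div_assoc, le_div_iff₀ (by positivity)]
    refine le_trans (mul_le_mul_of_nonneg_right ?_ (by positivity)) h4
    exact_mod_cast card_filter_superset_le k T
  calc ∑ S' ∈ Finset.powersetCard k (Finset.univ : Finset (Fin p)), x ^ (S ∩ S').card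
      = ∑ T ∈ S.powerset, (x - 1) ^ T.card *
        (((Finset.powersetCard k (Finset.univ : Finset (Fin p))).filter (T ⊆ ·)).card : ℕ) := by
        simp only [h1]
        rw [Finset.sum_comm]
        refine Finset.sum_congr rfl fun T _ => ?_
        rw [← Finset.sum_filter, Finset.sum_const, nsmul_eq_mul, mul_comm]
    _ ≤ ∑ T ∈ S.powerset, (x - 1) ^ T.card * (p.choose k * (k / p : ℝ) ^ T.card) :=
        Finset.sum_le_sum fun T hT => mul_le_mul_of_nonneg_left (h3 T hT) (by positivity)
    _ = p.choose k * ((x - 1) * (k / p) + 1) ^ k := by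
        have h5 := Finset.sum_pow_mul_eq_add_pow ((x - 1) * (k / p : ℝ)) 1 S
        rw [hS] at h5
        rw [← h5, Finset.mul_sum]
        refine Finset.sum_congr rfl fun T _ => ?_
        rw [one_pow, mul_one, mul_pow]
        ring
    _ ≤ p.choose k * Real.exp (x * k ^ 2 / p) := by
        refine mul_le_mul_of_nonneg_left ?_ (by positivity)
        have h6 : (x - 1) * (k / p : ℝ) + 1 ≤ Real.exp (x * (k / p)) := by
          refine le_trans ?_ (Real.add_one_le_exp _)
          have : (0 : ℝ) ≤ k / p := by positivity
          nlinarith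
        calc ((x - 1) * (k / p : ℝ) + 1) ^ k ≤ Real.exp (x * (k / p)) ^ k :=
              pow_le_pow_left₀ (by positivity) h6 k
          _ = _ := by
              rw [← Real.exp_nat_mul]
              congr 1
              ring

variable {p k : ℕ} {r : ℝ} {𝒟 : Set ℝ} {P : Measure (Fin p → ℝ)}

/-- The support of a signal as a finite set. -/
noncomputable def signalSupport (β : Fin p → ℝ) : Finset (Fin p) :=
  Finset.univ.filter fun j => β j ≠ 0

theorem measurableSet_signalSupport_eq (S : Finset (Fin p)) :
    MeasurableSet {β : Fin p → ℝ | signalSupport β = S} := by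
  have h : {β : Fin p → ℝ | signalSupport β = S} = ⋂ j, {β | β j ≠ 0 ↔ j ∈ S} := by
    ext β
    simp [signalSupport, Finset.ext_iff]
  rw [h]
  refine MeasurableSet.iInter fun j => ?_
  have hj : MeasurableSet {β : Fin p → ℝ | β j = 0} :=
    measurableSet_eq_fun (measurable_pi_apply j) measurable_const
  by_cases hS : j ∈ S
  · have h1 : {β : Fin p → ℝ | β j ≠ 0 ↔ j ∈ S} = {β | β j = 0}ᶜ := by
      ext β; simp [hS]
    exact h1 ▸ hj.compl
  · have h1 : {β : Fin p → ℝ | β j ≠ 0 ↔ j ∈ S} = {β | β j = 0} := by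
      ext β; simp [hS]
    exact h1 ▸ hj

theorem measurable_comp_signalSupport (F : Finset (Fin p) → Finset (Fin p) → ℝ) :
    Measurable fun q : (Fin p → ℝ) × (Fin p → ℝ) =>
      F (signalSupport q.1) (signalSupport q.2) := by
  let _ : MeasurableSpace (Finset (Fin p)) := ⊤
  have hs : Measurable (signalSupport : (Fin p → ℝ) → Finset (Fin p)) :=
    measurable_to_countable' fun S => measurableSet_signalSupport_eq S
  have hF : Measurable fun s : Finset (Fin p) × Finset (Fin p) => F s.1 s.2 :=
    Measurable.of_discrete
  exact hF.comp (hs.prodMap hs)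

theorem IsSparsePrior.measure_signalSupport (hP : IsSparsePrior k r 𝒟 P) {S : Finset (Fin p)}
    (hS : S.card = k) : P {β | signalSupport β = S} = ((p.choose k : ℕ) : ENNReal)⁻¹ := by
  rw [← hP.support_uniform S hS]
  congr 1
  ext β
  simp only [signalSupport, Set.mem_ofPred_eq, Finset.ext_iff, Set.ext_iff, Finset.mem_filter,
    Finset.mem_univ, true_and, Function.mem_support, Finset.mem_coe]

/-- The prescribed probabilities of the k-element supports already add up to 1, so no mass is left
for other sizes. -/
theorem IsSparsePrior.ae_card_signalSupport (hP : IsSparsePrior k r 𝒟 P) (hkp : k ≤ p) :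
    ∀ᵐ β ∂P, (signalSupport β).card = k := by
  have := hP.isProbabilityMeasure
  have h : {β : Fin p → ℝ | (signalSupport β).card = k} =
      ⋃ S ∈ Finset.powersetCard k (Finset.univ : Finset (Fin p)), {β | signalSupport β = S} := by
    ext β; simp
  have hm : MeasurableSet {β : Fin p → ℝ | (signalSupport β).card = k} := by
    rw [h]
    exact Finset.measurableSet_biUnion _ fun S _ => measurableSet_signalSupport_eq S
  have h1 : P {β : Fin p → ℝ | (signalSupport β).card = k} = 1 := by
    rw [h, measure_biUnion_finset]
    · rw [Finset.sum_congr rfl fun S hS =>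
        hP.measure_signalSupport (Finset.mem_powersetCard_univ.1 hS)]
      rw [Finset.sum_const, Finset.card_powersetCard, Finset.card_univ, Fintype.card_fin,
        nsmul_eq_mul]
      exact ENNReal.mul_inv_cancel (by exact_mod_cast (Nat.choose_pos hkp).ne')
        (ENNReal.natCast_ne_top _)
    · intro S _ S' _ hS
      exact Set.disjoint_left.2 fun β h1 h2 => hS (h1.symm.trans h2)
    · exact fun S _ => measurableSet_signalSupport_eq S
  exact (prob_compl_eq_zero_iff hm).2 h1

theorem IsSparsePrior.integral_signalSupport (hP : IsSparsePrior k r 𝒟 P) (hkp : k ≤ p)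
    (F : Finset (Fin p) → ℝ) :
    ∫ β, F (signalSupport β) ∂P =
      (p.choose k : ℝ)⁻¹ * ∑ S ∈ Finset.powersetCard k (Finset.univ : Finset (Fin p)), F S := by
  have := hP.isProbabilityMeasure
  have h : (fun β : Fin p → ℝ => F (signalSupport β)) =ᵐ[P] fun β =>
      ∑ S ∈ Finset.powersetCard k (Finset.univ : Finset (Fin p)),
      {β : Fin p → ℝ | signalSupport β = S}.indicator (fun _ => F S) β := by
    filter_upwards [hP.ae_card_signalSupport hkp] with β hβ
    rw [Finset.sum_eq_single (signalSupport β)]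
    · simp
    · intro S _ hS
      simp [hS.symm]
    · intro hn
      exact absurd (Finset.mem_powersetCard_univ.2 hβ) hn
  rw [integral_congr_ae h, integral_finsetSum _ fun S _ =>
    (integrable_const _).indicator (measurableSet_signalSupport_eq S), Finset.mul_sum]
  refine Finset.sum_congr rfl fun S hS => ?_
  rw [integral_indicator_const _ (measurableSet_signalSupport_eq S), measureReal_def,
    hP.measure_signalSupport (Finset.mem_powersetCard_univ.1 hS)]
  simp

theorem integrable_pow_overlap [IsProbabilityMeasure P] (x : ℝ) :
    Integrable (fun q : (Fin p → ℝ) × (Fin p → ℝ) =>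
      x ^ (signalSupport q.1 ∩ signalSupport q.2).card) (P.prod P) := by
  refine Integrable.of_bound (measurable_comp_signalSupport
    fun S S' => x ^ (S ∩ S').card).aestronglyMeasurable (max 1 |x| ^ p)
    (Eventually.of_forall fun q => ?_)
  rw [norm_pow, Real.norm_eq_abs]
  refine (pow_le_pow_left₀ (abs_nonneg x) (le_max_right 1 |x|) _).trans
    (pow_le_pow_right₀ (le_max_left _ _) ?_)
  exact (Finset.card_le_univ _).trans (by simp)

/-- Given the first signal, the support of the second is still uniform, and the bound does not
depend on the first. -/
theorem IsSparsePrior.integral_pow_overlap_le (hP : IsSparsePrior k r 𝒟 P) (hkp : k ≤ p) {x : ℝ}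
    (hx : 1 ≤ x) : ∫ q, x ^ (signalSupport q.1 ∩ signalSupport q.2).card ∂(P.prod P) ≤
      Real.exp (x * k ^ 2 / p) := by
  have := hP.isProbabilityMeasure
  have hint := integrable_pow_overlap (P := P) x
  rw [integral_prod _ hint]
  have hc : (0 : ℝ) < p.choose k := by exact_mod_cast Nat.choose_pos hkp
  calc ∫ β, ∫ β', x ^ (signalSupport β ∩ signalSupport β').card ∂P ∂P
      ≤ ∫ _, Real.exp (x * k ^ 2 / p) ∂P := by
        refine integral_mono_ae hint.integral_prod_left (integrable_const _) ?_
        filter_upwards [hP.ae_card_signalSupport hkp] with β hβ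
        rw [hP.integral_signalSupport hkp fun S' => x ^ (signalSupport β ∩ S').card]
        rw [inv_mul_le_iff₀ hc]
        exact sum_pow_card_inter_le hkp hx hβ
    _ = _ := by simp

end Overlap

/-! ### The chi-square bound for a fixed problem size -/

section Bounds

variable {p k : ℕ} {r : ℝ} {𝒟 : Set ℝ} {P : Measure (Fin p → ℝ)}

theorem abs_dotProduct_le_card_mul {β β' : Fin p → ℝ} {b : ℝ} (h : ‖β‖ ≤ b) (h' : ‖β'‖ ≤ b) :
    |β ⬝ᵥ β'| ≤ (signalSupport β ∩ signalSupport β').card * b ^ 2 := by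
  have h1 : β ⬝ᵥ β' = ∑ j ∈ signalSupport β ∩ signalSupport β', β j * β' j := by
    refine (Finset.sum_subset (Finset.subset_univ _) fun j _ hj => ?_).symm
    by_contra h2
    obtain ⟨h3, h4⟩ := mul_ne_zero_iff.1 h2
    exact hj (by simp [signalSupport, h3, h4])
  rw [h1, ← nsmul_eq_mul]
  refine (Finset.abs_sum_le_sum_abs _ _).trans (Finset.sum_le_card_nsmul _ _ _ fun j _ => ?_)
  rw [abs_mul, sq]
  exact mul_le_mul ((norm_le_pi_norm β j).trans h) ((norm_le_pi_norm β' j).trans h')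
    (abs_nonneg _) ((norm_nonneg β).trans h)

theorem IsSparsePrior.ae_sum_sq_eq (hP : IsSparsePrior k r 𝒟 P) :
    ∀ᵐ β ∂P, ∑ j, β j ^ 2 = r ^ 2 := by
  filter_upwards [hP.norm_eq] with β hβ
  rw [← hβ, EuclideanSpace.real_norm_sq_eq]

theorem IsSparsePrior.ae_norm_le (hP : IsSparsePrior k r 𝒟 P) :
    ∀ᵐ β ∂P, ‖β‖ ≤ signalSupNorm P := by
  -- A real essential supremum is meaningful only for a function that is essentially bounded above;
  -- the Euclidean norm supplies the bound.
  refine ae_le_essSup (f := fun β : Fin p → ℝ => ‖β‖) ⟨|r|, ?_⟩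
  rw [eventually_map]
  filter_upwards [hP.ae_sum_sq_eq] with β hβ
  refine (pi_norm_le_iff_of_nonneg (abs_nonneg r)).2 fun j => ?_
  rw [Real.norm_eq_abs, ← sq_le_sq, ← hβ]
  exact Finset.single_le_sum (f := fun j => β j ^ 2) (fun j _ => sq_nonneg _) (Finset.mem_univ j)

theorem negBinomCoeff_nonneg (n m : ℕ) : 0 ≤ negBinomCoeff n m := by
  unfold negBinomCoeff
  positivity

theorem negBinomCoeff_le {n m M : ℕ} {c : ℝ} (hm : m ≤ M) (hc : (n + M : ℝ) ≤ c) :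
    negBinomCoeff n m ≤ c ^ m / m.factorial := by
  unfold negBinomCoeff
  refine div_le_div_of_nonneg_right ?_ (by positivity)
  calc ∏ j ∈ Finset.range m, ((n : ℝ) + j) ≤ ∏ _j ∈ Finset.range m, c := by
        refine Finset.prod_le_prod (fun j _ => by positivity) fun j hj => ?_
        have : (j : ℝ) ≤ M := by exact_mod_cast (Finset.mem_range.1 hj).le.trans hm
        linarith
    _ = c ^ m := by simp

/-- The full series (1 - t)⁻ⁿ diverges for |t| > 1. Truncation keeps every factor n + j of the
coefficients below c, so the sum is dominated by an exponential series for all t. -/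
theorem abs_sum_negBinomCoeff_mul_pow_le {n M : ℕ} {c : ℝ} (hc : (n + M : ℝ) ≤ c) (t : ℝ) :
    |∑ m ∈ Finset.range (M + 1), negBinomCoeff n m * t ^ m| ≤ Real.exp (c * |t|) := by
  have hc0 : 0 ≤ c := le_trans (by positivity) hc
  refine (Finset.abs_sum_le_sum_abs _ _).trans (le_trans (Finset.sum_le_sum fun m hm => ?_)
    (Real.sum_le_exp_of_nonneg (by positivity : 0 ≤ c * |t|) (M + 1)))
  rw [abs_mul, abs_pow, abs_of_nonneg (negBinomCoeff_nonneg n m), mul_pow, mul_div_right_comm]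
  exact mul_le_mul_of_nonneg_right
    (negBinomCoeff_le (Nat.lt_succ_iff.1 (Finset.mem_range.1 hm)) hc) (by positivity)

/-- The chi-square bound in terms of the exponential moment of the overlap of two signals. -/
theorem IsSparsePrior.lowDegChiSq_slrd_le (hP : IsSparsePrior k r 𝒟 P) (hkp : k ≤ p) {n D : ℕ}
    {σ c γ : ℝ} (hσ : 0 < σ) (φ : unitInterval) (hc : (n + (D / 2 : ℕ) : ℝ) ≤ c) (hγ : 0 ≤ γ)
    (hcγ : c * (signalSupNorm P ^ 2 / (r ^ 2 + σ ^ 2)) ≤ γ) :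
    lowDegChiSq (slrdPlanted n p σ φ P) (mslrdNull n p r σ) D ≤
      (Real.exp (Real.exp γ * k ^ 2 / p) : ℝ) := by
  have := hP.isProbabilityMeasure
  have hc0 : 0 ≤ c := le_trans (by positivity) hc
  have hs : 0 < r ^ 2 + σ ^ 2 := by positivity
  refine (_root_.lowDegChiSq_slrd_le hσ φ P hP.ae_sum_sq_eq D).trans (EReal.coe_le_coe_iff.2 ?_)
  have hbound : ∀ᵐ q ∂(P.prod P), |∑ m ∈ Finset.range (D / 2 + 1),
      negBinomCoeff n m * ((q.1 ⬝ᵥ q.2) / (r ^ 2 + σ ^ 2)) ^ m| ≤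
      Real.exp γ ^ (signalSupport q.1 ∩ signalSupport q.2).card := by
    filter_upwards [Measure.quasiMeasurePreserving_fst.ae hP.ae_norm_le,
      Measure.quasiMeasurePreserving_snd.ae hP.ae_norm_le] with q h1 h2
    refine (abs_sum_negBinomCoeff_mul_pow_le hc _).trans ?_
    rw [← Real.exp_nat_mul]
    refine Real.exp_le_exp.2 ?_
    rw [abs_div, abs_of_pos hs]
    calc c * (|q.1 ⬝ᵥ q.2| / (r ^ 2 + σ ^ 2))
        ≤ c * (((signalSupport q.1 ∩ signalSupport q.2).card * signalSupNorm P ^ 2) /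
          (r ^ 2 + σ ^ 2)) := by
          gcongr
          exact abs_dotProduct_le_card_mul h1 h2
      _ = (signalSupport q.1 ∩ signalSupport q.2).card *
          (c * (signalSupNorm P ^ 2 / (r ^ 2 + σ ^ 2))) := by ring
      _ ≤ _ := by gcongr
  have hle : ∫ q, ∑ m ∈ Finset.range (D / 2 + 1),
      negBinomCoeff n m * ((q.1 ⬝ᵥ q.2) / (r ^ 2 + σ ^ 2)) ^ m ∂(P.prod P) ≤
      ∫ q, Real.exp γ ^ (signalSupport q.1 ∩ signalSupport q.2).card ∂(P.prod P) := by
    refine (Real.le_norm_self _).trans (norm_integral_le_of_norm_le (integrable_pow_overlap _) ?_)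
    simpa only [Real.norm_eq_abs] using hbound
  have := hP.integral_pow_overlap_le hkp (Real.one_le_exp hγ)
  linarith

/-- The sample size condition, solved for the exponent that each common support element contributes.
-/
theorem samples_bound {n p b r σ S θ ε : ℝ} (hn0 : 0 ≤ n) (hσ : 0 < σ) (hp : 1 ≤ p)
    (hθ' : θ ≤ 1 / 2) (hε' : ε < 1) (hS : S = r ^ 2 / σ ^ 2)
    (hn : n ≤ (1 - ε) * (1 - 2 * θ) * (r ^ 2 / b ^ 2) * ((S + 1) / S) * Real.log p) :
    n / (1 - ε) * (b ^ 2 / (r ^ 2 + σ ^ 2)) ≤ (1 - 2 * θ) * Real.log p := by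
  have h1 : 0 < 1 - ε := by linarith
  have hlog : 0 ≤ Real.log p := Real.log_nonneg hp
  have hR : 0 ≤ (1 - 2 * θ) * Real.log p := mul_nonneg (by linarith) hlog
  -- For r = 0 the right side of the sample bound is 0, so n = 0; for b = 0 the left side of the
  -- goal vanishes, whatever r²/0 means.
  by_cases hr : r = 0
  · subst hr
    have : n = 0 := le_antisymm (by simpa using hn) hn0
    simpa [this] using hR
  by_cases hb : b = 0
  · subst hb
    simpa using hR
  have hs : 0 < r ^ 2 + σ ^ 2 := by positivity
  have h2 : (S + 1) / S = (r ^ 2 + σ ^ 2) / r ^ 2 := by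
    rw [hS]; field_simp
  rw [h2] at hn
  rw [div_mul_div_comm, div_le_iff₀ (by positivity)]
  have hb2 : 0 < b ^ 2 := by positivity
  refine (mul_le_mul_of_nonneg_right hn hb2.le).trans_eq ?_
  field_simp

end Bounds

/-! ### Asymptotics and computational hardness -/

theorem exists_eventually_lowDegChiSq_slrd_le
    (p n k : ℕ → ℕ) (r σ : ℕ → ℝ) (φ : ℕ → unitInterval) (𝒟 : ℕ → Set ℝ)
    (prior : ∀ i, Measure (Fin (p i) → ℝ)) (hp : Tendsto p atTop atTop) (hσ : ∀ i, 0 < σ i)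
    (hprior : ∀ i, IsSparsePrior (k i) (r i) (𝒟 i) (prior i))
    (θ ε : ℝ) (hθ' : θ ≤ 1 / 2) (hε : 0 < ε) (hε' : ε < 1)
    (hk : (fun i => (k i : ℝ)) =O[atTop] fun i => (p i : ℝ) ^ θ)
    (hk' : ∀ i, (k i : ℝ) ≤ √(p i : ℝ))
    (SNR : ℕ → ℝ) (hSNR : ∀ i, SNR i = r i ^ 2 / σ i ^ 2)
    (hn : ∀ i, (n i : ℝ) ≤ (1 - ε) * (1 - 2 * θ) * (r i ^ 2 / signalSupNorm (prior i) ^ 2) *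
      ((SNR i + 1) / SNR i) * Real.log (p i)) :
    ∃ C : ℝ, ∀ᶠ i in atTop, ∀ D : ℕ, (D : ℝ) ≤ 2 * ε / (1 - ε) * n i →
      lowDegChiSq (slrdPlanted (n i) (p i) (σ i) (φ i) (prior i))
        (mslrdNull (n i) (p i) (r i) (σ i)) D ≤ C := by
  obtain ⟨K, hK⟩ := hk.bound
  refine ⟨Real.exp (K ^ 2), ?_⟩
  filter_upwards [hK, hp.eventually_ge_atTop 1] with i hKi hpi D hD
  have h1ε : 0 < 1 - ε := by linarith
  have hp1 : (1 : ℝ) ≤ p i := by exact_mod_cast hpi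
  have hp0 : (0 : ℝ) < p i := by linarith
  have hkp : k i ≤ p i := by
    have : √(p i : ℝ) ≤ p i := (Real.sqrt_le_left hp0.le).2 (by nlinarith)
    exact_mod_cast (hk' i).trans this
  -- This is where the admissible degree comes from: n + (1/2) · 2εn/(1-ε) = n/(1-ε), and the factor
  -- 1 - ε in the sample bound absorbs the loss.
  have hc : ((n i : ℝ) + (D / 2 : ℕ)) ≤ n i / (1 - ε) := by
    have h2 : ((D / 2 : ℕ) : ℝ) ≤ D / 2 := Nat.cast_div_le
    have h3 : (n i : ℝ) / (1 - ε) = n i + 2 * ε / (1 - ε) * n i / 2 := by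
      field_simp; ring
    rw [h3]
    linarith
  refine ((hprior i).lowDegChiSq_slrd_le hkp (hσ i) (φ i) hc
    (mul_nonneg (by linarith) (Real.log_nonneg hp1))
    (samples_bound (Nat.cast_nonneg _) (hσ i) hp1 hθ' hε' (hSNR i) (hn i))).trans
    (EReal.coe_le_coe_iff.2 (Real.exp_le_exp.2 ?_))
  rw [Real.norm_of_nonneg (by positivity), Real.norm_of_nonneg (by positivity)] at hKi
  -- With this weight per common element, the exponent x k²/p becomes (k/p^θ)², which the implied
  -- constant K of k = O(p^θ) bounds by K².
  have hx : Real.exp ((1 - 2 * θ) * Real.log (p i)) = p i / ((p i : ℝ) ^ θ) ^ 2 := by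
    rw [mul_comm, ← Real.rpow_def_of_pos hp0, Real.rpow_sub hp0, Real.rpow_one, mul_comm 2 θ,
      Real.rpow_mul hp0.le]
    norm_num
  rw [hx]
  have hpθ : 0 < (p i : ℝ) ^ θ := Real.rpow_pos_of_pos hp0 θ
  calc (p i / ((p i : ℝ) ^ θ) ^ 2 * (k i : ℝ) ^ 2 / p i : ℝ)
      = (k i / (p i : ℝ) ^ θ) ^ 2 := by field_simp
    _ ≤ K ^ 2 := pow_le_pow_left₀ (by positivity) ((div_le_iff₀ hpθ).2 hKi) 2

theorem tendsto_atTop_of_isLittleO_log {p n : ℕ → ℕ} (hp : Tendsto p atTop atTop)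
    (hn : (fun i => Real.log (p i)) =o[atTop] fun i => (n i : ℝ)) :
    Tendsto (fun i => (n i : ℝ)) atTop atTop := by
  have hlogp : Tendsto (fun i => Real.log (p i)) atTop atTop :=
    Real.tendsto_log_atTop.comp (tendsto_natCast_atTop_atTop.comp hp)
  refine tendsto_atTop_mono' _ ?_ hlogp
  filter_upwards [hn.bound one_pos, hlogp.eventually_ge_atTop 0] with i hi h0
  rwa [one_mul, Real.norm_of_nonneg h0, Real.norm_of_nonneg (Nat.cast_nonneg _)] at hi

/-- The dimension is n(p + 1) and p + 1 ≤ p² for p ≥ 2, so its logarithm is at most log n + 2 log p.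
-/
theorem isLittleO_log_dim {p n : ℕ → ℕ} (hp : Tendsto p atTop atTop)
    (hn : (fun i => Real.log (p i)) =o[atTop] fun i => (n i : ℝ)) :
    (fun i => Real.log (Fintype.card (DataIndex (n i) (p i)))) =o[atTop]
      fun i => (n i : ℝ) := by
  have hnt := tendsto_atTop_of_isLittleO_log hp hn
  have hlogn : (fun i => Real.log (n i)) =o[atTop] fun i => (n i : ℝ) :=
    Real.isLittleO_log_id_atTop.comp_tendsto hnt
  have hsum : (fun i => Real.log (n i) + 2 * Real.log (p i)) =o[atTop] fun i => (n i : ℝ) :=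
    hlogn.add (hn.const_mul_left 2)
  refine IsBigO.trans_isLittleO (IsBigO.of_bound 1 ?_) hsum
  filter_upwards [hnt.eventually_ge_atTop 1, hp.eventually_ge_atTop 2] with i hni hpi
  have hp2 : (2 : ℝ) ≤ p i := by exact_mod_cast hpi
  have hcard : ((Fintype.card (DataIndex (n i) (p i)) : ℕ) : ℝ) = n i * (p i + 1) := by
    simp [DataIndex]; ring
  rw [hcard, one_mul]
  have h1 : 1 ≤ (n i : ℝ) * (p i + 1) := by nlinarith
  have h2 : Real.log ((n i : ℝ) * (p i + 1)) ≤ Real.log (n i) + 2 * Real.log (p i) := by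
    rw [Real.log_mul (by positivity) (by positivity)]
    have h3 : Real.log ((p i : ℝ) + 1) ≤ Real.log ((p i : ℝ) ^ 2) :=
      Real.log_le_log (by positivity) (by nlinarith)
    rw [Real.log_pow] at h3
    push_cast at h3
    linarith
  rw [Real.norm_of_nonneg (Real.log_nonneg h1)]
  exact h2.trans (le_abs_self _)

theorem DetectionRequiresExpTime.of_le {F : ℕ → TestingProblem} {f g : ℕ → ℝ} {c : ℝ} (hc : 0 < c)
    (hfg : ∀ᶠ i in atTop, c * f i ≤ g i) (h : DetectionRequiresExpTime F g) :
    DetectionRequiresExpTime F f := by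
  intro A T hA
  obtain ⟨c', hc', a, ha⟩ := h A T hA
  refine ⟨c' * c, mul_pos hc' hc, a, ?_⟩
  filter_upwards [ha, hfg] with i hi hi'
  refine le_trans (Real.exp_le_exp.2 (div_le_div_of_nonneg_right ?_ (pow_nonneg ?_ a))) hi
  · rw [mul_assoc]
    exact mul_le_mul_of_nonneg_left hi' hc'.le
  · exact Real.log_natCast_nonneg _

theorem mainTheorem2
    (p n k : ℕ → ℕ) (r σ : ℕ → ℝ) (φ : ℕ → unitInterval) (𝒟 : ℕ → Set ℝ)
    (prior : ∀ i, Measure (Fin (p i) → ℝ))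
    (hp : Tendsto p atTop atTop)
    (hσ : ∀ i, 0 < σ i)
    (hprior : ∀ i, IsSparsePrior (k i) (r i) (𝒟 i) (prior i))
    (θ ε : ℝ) (hθ : 0 < θ) (hθ' : θ ≤ 1 / 2) (hε : 0 < ε) (hε' : ε < 1)
    (hk : (fun i => (k i : ℝ)) =O[atTop] fun i => (p i : ℝ) ^ θ)
    (hk' : ∀ i, (k i : ℝ) ≤ √(p i : ℝ))
    (SNR : ℕ → ℝ) (hSNR : ∀ i, SNR i = r i ^ 2 / σ i ^ 2)
    (hn : ∀ i, (n i : ℝ) ≤ (1 - ε) * (1 - 2 * θ) * (r i ^ 2 / signalSupNorm (prior i) ^ 2) *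
      ((SNR i + 1) / SNR i) * Real.log (p i)) :
    (∃ C : ℝ, ∀ᶠ i in atTop, ∀ D : ℕ, (D : ℝ) ≤ 2 * ε / (1 - ε) * n i →
      lowDegChiSq (slrdPlanted (n i) (p i) (σ i) (φ i) (prior i))
        (mslrdNull (n i) (p i) (r i) (σ i)) D ≤ C) ∧
    ((fun i => Real.log (p i)) =o[atTop] (fun i => (n i : ℝ)) →
      LowDegreeConjectureFor
        (fun i => slrd (n i) (p i) (k i) (r i) (σ i) (φ i) (prior i)) →
      NoPolyTimeDetection
        (fun i => slrd (n i) (p i) (k i) (r i) (σ i) (φ i) (prior i)) ∧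
      DetectionRequiresExpTime
        (fun i => slrd (n i) (p i) (k i) (r i) (σ i) (φ i) (prior i)) fun i => n i) := by
  have hchi := exists_eventually_lowDegChiSq_slrd_le p n k r σ φ 𝒟 prior hp hσ hprior θ ε hθ' hε
    hε' hk hk' SNR hSNR hn
  refine ⟨hchi, fun hlog hconj => ?_⟩
  have h1ε : 0 < 1 - ε := by linarith
  have hc : 0 < ε / (1 - ε) := by positivity
  have hnt := tendsto_atTop_of_isLittleO_log hp hlog
  -- The largest admissible degree. Rounding loses less than 1, hence at most half of the value once
  -- εn/(1-ε) ≥ 1, so D is still of order n.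
  let D : ℕ → ℕ := fun i => ⌊2 * ε / (1 - ε) * n i⌋₊
  have hD : ∀ᶠ i in atTop, ε / (1 - ε) * n i ≤ D i := by
    filter_upwards [(hnt.const_mul_atTop hc).eventually_ge_atTop 1] with i hi
    have h1 := Nat.lt_floor_add_one (2 * ε / (1 - ε) * n i : ℝ)
    have h2 : 2 * ε / (1 - ε) * (n i : ℝ) = ε / (1 - ε) * n i + ε / (1 - ε) * n i := by ring
    change _ ≤ ((⌊2 * ε / (1 - ε) * (n i : ℝ)⌋₊ : ℕ) : ℝ)
    linarith
  have hnD : (fun i => (n i : ℝ)) =O[atTop] fun i => (D i : ℝ) := by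
    refine IsBigO.of_bound (ε / (1 - ε))⁻¹ ?_
    filter_upwards [hD] with i hi
    rw [Real.norm_of_nonneg (Nat.cast_nonneg _), Real.norm_of_nonneg (Nat.cast_nonneg _),
      le_inv_mul_iff₀ hc]
    exact hi
  obtain ⟨h1, h2⟩ := hconj D ((isLittleO_log_dim hp hlog).trans_isBigO hnD) <| by
    obtain ⟨C, hC⟩ := hchi
    exact ⟨C, hC.mono fun i hi => hi _ (Nat.floor_le (by positivity))⟩
  exact ⟨h1, h2.of_le hc hD⟩
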